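/- \textbf{Setting.} Let $G$ be a locally compact, second countable (Hausdorff) group with left Haar measure $dx$ and modular function $\Delta$, normalized by $|Ex|=\Delta(x)|E|$. Let $w:G\to(0,\infty)$ be continuous with $w(xy)\le w(x)w(y)$ and $w(x)=w(x^{-1})$. For a positive weight $v$ let $L_{p,v}(G)=\{f: vf\in L_p(G)\}$ with $\|f\|_{L_{p,v}}=\|vf\|_{L_p}$, and let $f*g(x)=\int_G f(y)g(y^{-1}x)\,dy$. Let $\pi$ be a strongly continuous unitary representation of $G$ on a separable complex Hilbert space $\mathcal H$ and let $u\in\mathcal H$ be such that the voice transform $Vv(x)=\langle v,\pi(x)u\rangle$ is an isometry of $\mathcal H$ into $L_2(G)$. Put $K=Vu$ and assume $K\in L_{p,w}(G)$ for all $1<p<\infty$. Let $\mathcal S_w=\{v\in\mathcal H: Vv\in L_{p,w}(G)\ \forall\,1<p<\infty\}$ with the seminorms $\|Vv\|_{L_{p,w}}$, $1<p<\infty$, let $\mathcal S_w'$ be its anti-dual (the continuous conjugate-linear functionals), into which $\mathcal H$ embeds by $h\mapsto\langle h,\cdot\rangle$, and let $V_eT(x)=\langle T,\pi(x)u\rangle$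 for $T\in\mathcal S_w'$. For $1<r<\infty$ and a continuous $m:G\to(0,\infty)$ with $m(xy)\le w(x)m(y)$ and $m(xy)\le m(x)w(y)$, let $\mathrm{Co}(L_{r,m})=\{T\in\mathcal S_w': V_eT\in L_{r,m}(G)\}$ with $\|T\|=\|V_eT\|_{L_{r,m}}$. Let $U\subset G$ be a compact unit neighborhood and let $X=(x_i)_{i\in I}$ be a relatively separated family in $G$, that is, for every compact unit neighborhood $Q$ there is $N\in\mathbb N$ with $\sum_{i}\chi_{x_iQ}\le N$. Suppose there is a $U$-BUPU $\Psi=(\psi_i)_{i\in I}$ with localizing family $X$, that is, measurable functions $\psi_i:G\to[0,1]$ with $\psi_i=0$ outside $x_iU$ and $\sum_i\psi_i=1$ on $G$; fix one. Let $\ell_{r,m_X}(I)$ be the space of all $c\in\mathbb C^I$ with $\|c\|=\big(\sum_i (m(x_i)|c_i|)^r\big)^{1/r}<\infty$. Call $(r,m)$ as above \emph{admissible} if (i) $RC_K:f\mapsto f*K$ is well defined and bounded on $L_{r,m}(G)$ (in particular, the integral defining $f*K(x)$ converges absolutely for almost every $x$, for each $f\in L_{r,m}(G)$), and (ii) there is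 a continuous $W:G\to\mathbb C$ with $W*K=K$, such that $x\mapsto\|W\|_{L_\infty(Qx)}$ belongs to $L_{1,w}(G)\cap L_{1,w\Delta^{-1}}(G)$ for some compact unit neighborhood $Q$, and $C_U\cdot\|RC_K\|_{L_{r,m}\to L_{r,m}}<1$, where $C_U=\max\{\|\mathrm{osc}_UW\|_{L_{1,w}},\|\mathrm{osc}_UW\|_{L_{1,w\Delta^{-1}}}\}$ and $\mathrm{osc}_UW(x)=\sup_{y\in U}|W(yx)-W(x)|$. \textbf{Theorem.} For every admissible $(r,m)$ the family $(\pi(x_i)u)_{i\in I}$ is a family of atoms for $\mathrm{Co}(L_{r,m})$ with coefficient space $\ell_{r,m_X}(I)$: the synthesis operator $$\mathrm{Synth}:\ell_{r,m_X}(I)\to\mathrm{Co}(L_{r,m}),\qquad (c_i)_{i\in I}\mapsto\sum_{i\in I}c_i\,\pi(x_i)u,$$ is well defined, linear and bounded, with unconditional convergence of the series in $\mathrm{Co}(L_{r,m})$, and there is a bounded linear operator $C_{r,m}:\mathrm{Co}(L_{r,m})\to\ell_{r,m_X}(I)$ with $\mathrm{Synth}\circ C_{r,m}=\mathrm{id}_{\mathrm{Co}(L_{r,m})}$.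 Moreover, the operators $C_{r,m}$ can be chosen, simultaneously for all admissible $(r,m)$, so that their action does not depend on $(r,m)$: if $(r_1,m_1)$ and $(r_2,m_2)$ are admissible and $T\in\mathrm{Co}(L_{r_1,m_1})\cap\mathrm{Co}(L_{r_2,m_2})$, then $C_{r_1,m_1}T=C_{r_2,m_2}T$. -/

import Mathlib

open MeasureTheory Topology Filter
open scoped ENNReal NNReal

noncomputable section

/-! ### Functions on the group -/

section GroupFunctions

variable {G : Type*} [Group G]

/-- `X` is relatively separated: for every compact unit neighbourhood `Q`, the number of translates
`x_i Q` that contain a given point is bounded by a constant `N = N(X, Q)`. -/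
def IsRelativelySeparated [TopologicalSpace G] {I : Type*} (X : I → G) : Prop :=
  ∀ Q : Set G, IsCompact Q → Q ∈ 𝓝 (1 : G) →
    ∃ N : ℕ, ∀ x : G, {i : I | x ∈ (fun q => X i * q) '' Q}.encard ≤ N

/-- `ψ` is a `U`-BUPU (bounded uniform partition of unity) with localizing family `X`. -/
structure IsBUPU [TopologicalSpace G] [MeasurableSpace G] {I : Type*}
    (U : Set G) (X : I → G) (ψ : I → G → ℝ) : Prop where
  measurable : ∀ i, Measurable (ψ i)
  mem_Icc : ∀ i x, ψ i x ∈ Set.Icc (0 : ℝ) 1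
  relSep : IsRelativelySeparated X
  eq_zero : ∀ i x, x ∉ (fun q => X i * q) '' U → ψ i x = 0
  sum_eq_one : ∀ x, HasSum (fun i => ψ i x) 1

/-- The oscillation `osc_U f (x) = sup_{u ∈ U} |f (u x) - f x|`. -/
def osc (U : Set G) (f : G → ℂ) (x : G) : ℝ≥0∞ :=
  ⨆ u ∈ U, ‖f (u * x) - f x‖ₑ

variable [MeasurableSpace G]

/-- The local maximal function `x ↦ ‖f‖_{L_∞(Q x)}`. -/
def maxFun (μ : Measure G) (Q : Set G) (f : G → ℂ) (x : G) : ℝ≥0∞ :=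
  eLpNorm f ⊤ (μ.restrict ((fun q => q * x) '' Q))

/-- The `L_{1,v}`-norm of a nonnegative function. -/
def normL1 (μ : Measure G) (v : G → ℝ) (F : G → ℝ≥0∞) : ℝ≥0∞ :=
  ∫⁻ x, F x * ENNReal.ofReal (v x) ∂μ

/-- The convolution `f * g (x) = ∫ f(y) g(y⁻¹ x) dy`. -/
def groupConv (μ : Measure G) (f g : G → ℂ) (x : G) : ℂ :=
  ∫ y, f y * g (y⁻¹ * x) ∂μ

/-- `f` and `g` are convolvable: the integral that defines `f * g (x)` converges absolutely for
almost every `x`. -/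
def Convolvable (μ : Measure G) (f g : G → ℂ) : Prop :=
  ∀ᵐ x ∂μ, Integrable (fun y => f y * g (y⁻¹ * x)) μ

/-- Membership in the weighted space `L_{p,v}(G)`. -/
def MemLpW (μ : Measure G) (v : G → ℝ) (p : ℝ≥0∞) (f : G → ℂ) : Prop :=
  MemLp (fun x => (v x : ℂ) * f x) p μ

/-- The norm of the weighted space `L_{p,v}(G)`. -/
def normLpW (μ : Measure G) (v : G → ℝ) (p : ℝ≥0∞) (f : G → ℂ) : ℝ≥0∞ :=
  eLpNorm (fun x => (v x : ℂ) * f x) p μ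

/-- The operator norm of `f ↦ f * k` on `L_{p,v}(G)`: the least constant `c` such that
`‖f * k‖ ≤ c ‖f‖` for all `f ∈ L_{p,v}(G)` (it is infinite if there is no finite one). -/
def normRC (μ : Measure G) (v : G → ℝ) (p : ℝ≥0∞) (k : G → ℂ) : ℝ≥0∞ :=
  sInf {c : ℝ≥0∞ | ∀ f, MemLpW μ v p f →
    normLpW μ v p (groupConv μ f k) ≤ c * normLpW μ v p f}

/-- The right convolution operator `f ↦ f * k` is well defined and bounded on `L_{p,v}(G)`. -/
def BoundedRC (μ : Measure G) (v : G → ℝ) (p : ℝ≥0∞) (k : G → ℂ) : Prop :=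
  (∀ f, MemLpW μ v p f → Convolvable μ f k ∧ MemLpW μ v p (groupConv μ f k)) ∧
    normRC μ v p k < ⊤

end GroupFunctions

/-! ### The modular function -/

section Modular

variable {G : Type*} [Group G] [TopologicalSpace G] [IsTopologicalGroup G] [LocallyCompactSpace G]

/-- The modular function `Δ`, normalized by `μ (E x) = Δ(x) μ (E)` for a left Haar measure `μ`.
(Mathlib's `modularCharacter` is `x ↦ μ (· x⁻¹) / μ`, hence the inverse.) -/
def modularFn (x : G) : ℝ := (Measure.modularCharacter x⁻¹ : ℝ≥0)

theorem measure_mul_right_eq_modularFn [SecondCountableTopology G]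
    [MeasurableSpace G] [BorelSpace G] (μ : Measure G)
    [μ.IsHaarMeasure] (x : G) (E : Set G) :
    μ ((fun y => y * x) '' E) = ENNReal.ofReal (modularFn x) * μ E := by
  have h := Measure.map_right_mul_eq_modularCharacterFun_smul μ x⁻¹
  have h2 : (Measure.map (· * x⁻¹) μ) E = μ ((fun y => y * x) '' E) := by
    have := (Homeomorph.mulRight x⁻¹).toMeasurableEquiv.map_apply (μ := μ) E
    simp only [Homeomorph.toMeasurableEquiv_coe, Homeomorph.coe_mulRight] at this
    rw [this, ← Set.image_mul_right', inv_inv]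
  rw [← h2, h]
  simp only [Measure.smul_apply, modularFn, ENNReal.ofReal_coe_nnreal]
  rfl

end Modular

/-! ### Seminorms that come from `L_p` -/

section LpSeminorm

variable {G : Type*} [MeasurableSpace G] {E : Type*} [AddCommGroup E] [Module ℂ E]

/-- The seminorm `e ↦ ‖Φ e‖_{L_p}` for a linear map `Φ` with values in `L_p`, `p ≥ 1`. -/
def lpSeminorm (μ : Measure G) (p : ℝ≥0∞) (hp : 1 ≤ p) (Φ : E →ₗ[ℂ] (G → ℂ))
    (hΦ : ∀ e, MemLp (Φ e) p μ) : Seminorm ℂ E :=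
  Seminorm.of (fun e => (eLpNorm (Φ e) p μ).toReal)
    (fun a b => by
      rw [map_add, ← ENNReal.toReal_add (hΦ a).eLpNorm_ne_top (hΦ b).eLpNorm_ne_top]
      exact ENNReal.toReal_mono
        (ENNReal.add_ne_top.2 ⟨(hΦ a).eLpNorm_ne_top, (hΦ b).eLpNorm_ne_top⟩)
        (eLpNorm_add_le (hΦ a).1 (hΦ b).1 hp))
    (fun c a => by
      rw [map_smul, eLpNorm_const_smul, ENNReal.toReal_mul]
      simp)

end LpSeminorm

/-! ### The setting of coorbit theory -/

/-- The standing data: a control weight `w` on the group `G`, a strongly continuous unitary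
representation `π` of `G` on the Hilbert space `H`, and a vector `u` such that the voice transform
`v ↦ (x ↦ ⟨v, π(x) u⟩)` is an isometry from `H` into `L_2(G)` and the kernel
`K(x) = ⟨u, π(x) u⟩` belongs to `L_{p,w}(G)` for all `1 < p < ∞`. Mathlib's inner product
`inner ℂ a b` is linear in `b` and conjugate-linear in `a`. -/
structure CoorbitSetting {G : Type*} [Group G] [TopologicalSpace G] [MeasurableSpace G]
    (μ : Measure G) (H : Type*) [NormedAddCommGroup H] [InnerProductSpace ℂ H] where
  w : G → ℝ
  w_continuous : Continuous w
  w_pos : ∀ x, 0 < w x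
  w_mul_le : ∀ x y, w (x * y) ≤ w x * w y
  w_inv : ∀ x, w x = w x⁻¹
  π : G →* (H ≃ₗᵢ[ℂ] H)
  π_continuous : ∀ v, Continuous fun x => π x v
  u : H
  isometry : ∀ v, eLpNorm (fun x => inner ℂ (π x u) v) 2 μ = ‖v‖ₑ
  kernel_mem : ∀ p : ℝ≥0∞, 1 < p → p < ⊤ → MemLpW μ w p (fun x => inner ℂ (π x u) u)

namespace CoorbitSetting

variable {G : Type*} [Group G] [TopologicalSpace G] [MeasurableSpace G]
  {μ : Measure G} {H : Type*} [NormedAddCommGroup H] [InnerProductSpace ℂ H]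

/-- The voice transform `V v (x) = ⟨v, π(x) u⟩`. -/
def voice (S : CoorbitSetting μ H) (v : H) (x : G) : ℂ := inner ℂ (S.π x S.u) v

/-- The reproducing kernel `K = V u`. -/
def kernel (S : CoorbitSetting μ H) : G → ℂ := S.voice S.u

theorem one_le_w (S : CoorbitSetting μ H) (x : G) : 1 ≤ S.w x := by
  have h1 : 1 ≤ S.w 1 := by
    have := S.w_mul_le 1 1
    rw [mul_one] at this
    nlinarith [S.w_pos 1]
  have h2 := S.w_mul_le x x⁻¹
  rw [mul_inv_cancel, ← S.w_inv] at h2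
  nlinarith [S.w_pos x]

theorem voice_continuous (S : CoorbitSetting μ H) (v : H) : Continuous (S.voice v) :=
  (S.π_continuous S.u).inner continuous_const

theorem voice_translate (S : CoorbitSetting μ H) (x y : G) :
    S.voice (S.π x S.u) y = S.kernel (x⁻¹ * y) := by
  have h : S.π y S.u = S.π x (S.π (x⁻¹ * y) S.u) := by
    conv_lhs => rw [← mul_inv_cancel_left x y, map_mul]
    rfl
  simp only [kernel, voice]
  rw [h, LinearIsometryEquiv.inner_map_map]

/-- The kernel's left translates belong to every `L_{p,v}(G)` with `v` dominated by `w`. -/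
theorem memLpW_translate [IsTopologicalGroup G] [SecondCountableTopology G] [BorelSpace G]
    [μ.IsMulLeftInvariant] (S : CoorbitSetting μ H)
    {p : ℝ≥0∞} (hp : 1 < p) (hp' : p < ⊤) (v : G → ℝ) (hv : Continuous v) (hv0 : ∀ x, 0 < v x)
    (hvw : ∀ x y, v (x * y) ≤ v x * S.w y) (x : G) :
    MemLpW μ v p (S.voice (S.π x S.u)) := by
  have h1 : MemLp (fun y => (S.w (x⁻¹ * y) : ℂ) * S.kernel (x⁻¹ * y)) p μ :=
    (S.kernel_mem p hp hp').comp_measurePreserving (measurePreserving_mul_left μ x⁻¹)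
  refine MemLp.of_le_mul (c := v x) h1 ?_ (Eventually.of_forall fun y => ?_)
  · exact ((Complex.continuous_ofReal.comp hv).mul
      (S.voice_continuous _)).aestronglyMeasurable
  · have h2 := hvw x (x⁻¹ * y)
    rw [mul_inv_cancel_left] at h2
    rw [S.voice_translate, norm_mul, norm_mul, Complex.norm_real, Complex.norm_real,
      Real.norm_of_nonneg (hv0 _).le, Real.norm_of_nonneg (S.w_pos _).le, ← mul_assoc]
    exact mul_le_mul_of_nonneg_right h2 (norm_nonneg _)

/-- The voice transform, weighted by `v`, as a linear map. -/
def weightedVoice (S : CoorbitSetting μ H) (v : G → ℝ) : H →ₗ[ℂ] (G → ℂ) where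
  toFun h x := (v x : ℂ) * S.voice h x
  map_add' a b := by
    funext x
    simp only [voice, inner_add_right, mul_add, Pi.add_apply]
  map_smul' c a := by
    funext x
    simp only [voice, inner_smul_right, Pi.smul_apply, smul_eq_mul, RingHom.id_apply]
    ring

/-! ### The test space and its anti-dual -/

/-- The vectors `v ∈ H` with `V v ∈ L_{p,w}(G)` for all `1 < p < ∞`. -/
def testSubmodule (S : CoorbitSetting μ H) : Submodule ℂ H where
  carrier := {v | ∀ p : ℝ≥0∞, 1 < p → p < ⊤ → MemLpW μ S.w p (S.voice v)}
  add_mem' {a b} ha hb p hp hp' := by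
    change MemLp (S.weightedVoice S.w (a + b)) p μ
    rw [map_add]
    exact (ha p hp hp').add (hb p hp hp')
  zero_mem' p hp hp' := by
    change MemLp (S.weightedVoice S.w 0) p μ
    rw [map_zero]
    exact MemLp.zero
  smul_mem' c a ha p hp hp' := by
    change MemLp (S.weightedVoice S.w (c • a)) p μ
    rw [map_smul]
    exact (ha p hp hp').const_smul c

/-- The test space `S_w`, a type of its own because its topology is not the one of `H`. -/
def TestSpace (S : CoorbitSetting μ H) : Type _ := S.testSubmodule

namespace TestSpace

instance (S : CoorbitSetting μ H) : AddCommGroup S.TestSpace :=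
  inferInstanceAs (AddCommGroup S.testSubmodule)

instance (S : CoorbitSetting μ H) : Module ℂ S.TestSpace :=
  inferInstanceAs (Module ℂ S.testSubmodule)

/-- The inclusion of the test space into `H`. -/
def incl (S : CoorbitSetting μ H) : S.TestSpace →ₗ[ℂ] H := S.testSubmodule.subtype

/-- The seminorms `v ↦ ‖V v‖_{L_{p,w}}`, `1 < p < ∞`, of the test space. -/
def seminorms (S : CoorbitSetting μ H) :
    SeminormFamily ℂ S.TestSpace (Set.Ioo (1 : ℝ≥0∞) ⊤) := fun p =>
  lpSeminorm μ p p.2.1.le (S.weightedVoice S.w ∘ₗ incl S) fun v => v.2 p p.2.1 p.2.2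

instance : Nonempty (Set.Ioo (1 : ℝ≥0∞) ⊤) := ⟨⟨2, by norm_num, by norm_num⟩⟩

/-- The locally convex topology of the test space, given by its family of seminorms. -/
instance (S : CoorbitSetting μ H) : TopologicalSpace S.TestSpace :=
  (seminorms S).moduleFilterBasis.topology

theorem withSeminorms (S : CoorbitSetting μ H) : WithSeminorms (seminorms S) := ⟨rfl⟩

end TestSpace

/-- The anti-dual `S_w'`: the continuous conjugate-linear functionals on the test space. -/
abbrev AntiDual (S : CoorbitSetting μ H) : Type _ := S.TestSpace →L⋆[ℂ] ℂ

theorem norm_incl_le (S : CoorbitSetting μ H) (v : S.TestSpace) :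
    ‖TestSpace.incl S v‖ ≤ TestSpace.seminorms S ⟨2, by norm_num, by norm_num⟩ v := by
  have h := S.isometry (TestSpace.incl S v)
  have h3 : MemLp (S.weightedVoice S.w (TestSpace.incl S v)) 2 μ :=
    v.2 2 (by norm_num) (by norm_num)
  change _ ≤ (eLpNorm (S.weightedVoice S.w (TestSpace.incl S v)) 2 μ).toReal
  rw [← toReal_enorm, ← h]
  refine ENNReal.toReal_mono h3.eLpNorm_ne_top (eLpNorm_mono fun x => ?_)
  change ‖S.voice (TestSpace.incl S v) x‖ ≤ ‖(S.w x : ℂ) * S.voice (TestSpace.incl S v) x‖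
  rw [norm_mul, Complex.norm_real, Real.norm_of_nonneg (S.w_pos x).le]
  exact le_mul_of_one_le_left (norm_nonneg _) (S.one_le_w x)

/-- The embedding of `H` into `S_w'`: `h` acts as `v ↦ ⟨h, v⟩`. -/
def embed (S : CoorbitSetting μ H) (h : H) : S.AntiDual where
  toFun v := inner ℂ (TestSpace.incl S v) h
  map_add' a b := by rw [map_add, inner_add_left]
  map_smul' c a := by rw [map_smul, inner_smul_left]; rfl
  cont := by
    let f : S.TestSpace →ₛₗ[starRingEnd ℂ] ℂ :=
      { toFun := fun v => inner ℂ (TestSpace.incl S v) h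
        map_add' := fun a b => by rw [map_add, inner_add_left]
        map_smul' := fun c a => by rw [map_smul, inner_smul_left]; rfl }
    refine (TestSpace.withSeminorms S).continuous_normedSpace_rng ℂ f
      ⟨{⟨2, by norm_num, by norm_num⟩}, ‖h‖₊, fun v => ?_⟩
    change ‖(inner ℂ (TestSpace.incl S v) h : ℂ)‖ ≤ _
    rw [Finset.sup_singleton]
    change _ ≤ ‖h‖ * TestSpace.seminorms S _ v
    rw [mul_comm]
    exact (norm_inner_le_norm _ _).trans
      (mul_le_mul_of_nonneg_right (S.norm_incl_le v) (norm_nonneg _))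

section ExtendedVoice

variable [BorelSpace G] [SecondCountableTopology G] [IsTopologicalGroup G]
  [μ.IsMulLeftInvariant]

/-- The vector `π(x) u` as an element of the test space. -/
def testAtom (S : CoorbitSetting μ H) (x : G) : S.TestSpace :=
  ⟨S.π x S.u, fun _ hp hp' =>
    S.memLpW_translate hp hp' S.w S.w_continuous S.w_pos S.w_mul_le x⟩

/-- The extended voice transform `V_e T (x) = ⟨T, π(x) u⟩`. -/
def extVoice (S : CoorbitSetting μ H) (T : S.AntiDual) (x : G) : ℂ := T (S.testAtom x)

theorem extVoice_embed (S : CoorbitSetting μ H) (h : H) : S.extVoice (S.embed h) = S.voice h := rfl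

/-- The extended voice transform, weighted by `v`, as a linear map. -/
def weightedExtVoice (S : CoorbitSetting μ H) (v : G → ℝ) : S.AntiDual →ₗ[ℂ] (G → ℂ) where
  toFun T x := (v x : ℂ) * S.extVoice T x
  map_add' a b := by
    funext x
    exact mul_add _ _ _
  map_smul' c a := by
    funext x
    exact mul_left_comm _ _ _

end ExtendedVoice

/-! ### The model spaces, the sequence spaces and the coorbit spaces -/

/-- The parameters of a model space `L_{r,m}(G)`: an exponent `r ∈ (1, ∞)` and a `w`-moderate
weight `m`. -/
structure Model (S : CoorbitSetting μ H) where
  r : ℝ≥0∞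
  one_lt_r : 1 < r
  r_lt_top : r < ⊤
  m : G → ℝ
  m_continuous : Continuous m
  m_pos : ∀ x, 0 < m x
  m_mul_le_left : ∀ x y, m (x * y) ≤ S.w x * m y
  m_mul_le_right : ∀ x y, m (x * y) ≤ m x * S.w y

variable {S : CoorbitSetting μ H}

namespace Model

/-- The map `c ↦ (m(x_i) c_i)_i`. -/
def weightSeq (M : S.Model) {I : Type*} (X : I → G) : (I → ℂ) →ₗ[ℂ] (I → ℂ) where
  toFun c i := (M.m (X i) : ℂ) * c i
  map_add' _ _ := funext fun _ => mul_add _ _ _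
  map_smul' _ _ := funext fun _ => mul_left_comm _ _ _

/-- The sequences in `ℓ_{r,m_X}(I)`, where `(m_X)_i = m(x_i)`. -/
def ellSubmodule (M : S.Model) {I : Type*} (X : I → G) : Submodule ℂ (I → ℂ) where
  carrier := {c | Memℓp (E := fun _ : I => ℂ) (M.weightSeq X c) M.r}
  add_mem' {a b} ha hb := by
    rw [Set.mem_ofPred_eq, map_add]
    exact Memℓp.add ha hb
  zero_mem' := by
    rw [Set.mem_ofPred_eq, map_zero]
    exact zero_memℓp
  smul_mem' c a ha := by
    rw [Set.mem_ofPred_eq, map_smul]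
    exact Memℓp.const_smul ha c

/-- The weighted sequence space `ℓ_{r,m_X}(I)`. -/
def Ell (M : S.Model) {I : Type*} (X : I → G) : Type _ := ellSubmodule M X

variable (M : S.Model) {I : Type*} (X : I → G)

instance : AddCommGroup (Ell M X) := inferInstanceAs (AddCommGroup (ellSubmodule M X))

instance : Module ℂ (Ell M X) := inferInstanceAs (Module ℂ (ellSubmodule M X))

/-- A sequence in `ℓ_{r,m_X}(I)` as a function on the index set. -/
def coeffs : Ell M X →ₗ[ℂ] (I → ℂ) := (ellSubmodule M X).subtype

/-- The map `c ↦ (m(x_i) c_i)_i` into the unweighted sequence space. -/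
def toLp : Ell M X →ₗ[ℂ] lp (fun _ : I => ℂ) M.r where
  toFun c := ⟨M.weightSeq X (coeffs M X c), c.2⟩
  map_add' a b := Subtype.ext ((M.weightSeq X ∘ₗ coeffs M X).map_add a b)
  map_smul' z a := Subtype.ext ((M.weightSeq X ∘ₗ coeffs M X).map_smul z a)

theorem toLp_injective : Function.Injective (toLp M X) := by
  intro a b h
  have h1 : M.weightSeq X (coeffs M X a) = M.weightSeq X (coeffs M X b) := congrArg Subtype.val h
  refine Subtype.ext (funext fun i => ?_)
  exact mul_left_cancel₀ (Complex.ofReal_ne_zero.2 (M.m_pos (X i)).ne') (congrFun h1 i)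

/-- The norm `‖c‖ = ‖(m(x_i) c_i)_i‖_{ℓ_r}`. -/
instance : NormedAddCommGroup (Ell M X) :=
  haveI : Fact (1 ≤ M.r) := ⟨M.one_lt_r.le⟩
  NormedAddCommGroup.induced (Ell M X) (lp (fun _ : I => ℂ) M.r) (toLp M X) (toLp_injective M X)

instance : NormedSpace ℂ (Ell M X) :=
  haveI : Fact (1 ≤ M.r) := ⟨M.one_lt_r.le⟩
  NormedSpace.induced ℂ (Ell M X) (lp (fun _ : I => ℂ) M.r) (toLp M X)

section Co

variable [BorelSpace G] [SecondCountableTopology G] [IsTopologicalGroup G] [μ.IsMulLeftInvariant]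

/-- The functionals `T ∈ S_w'` with `V_e T ∈ L_{r,m}(G)`. -/
def coSubmodule (M : S.Model) : Submodule ℂ S.AntiDual where
  carrier := {T | MemLpW μ M.m M.r (S.extVoice T)}
  add_mem' {a b} ha hb := by
    change MemLp (S.weightedExtVoice M.m (a + b)) M.r μ
    rw [map_add]
    exact MemLp.add ha hb
  zero_mem' := by
    change MemLp (S.weightedExtVoice M.m 0) M.r μ
    rw [map_zero]
    exact MemLp.zero
  smul_mem' c a ha := by
    change MemLp (S.weightedExtVoice M.m (c • a)) M.r μ
    rw [map_smul]
    exact MemLp.const_smul ha c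

/-- The coorbit space `Co(L_{r,m})`, a type of its own because its norm is not inherited from
`S_w'`. -/
def Co (M : S.Model) : Type _ := coSubmodule M

variable (M : S.Model)

instance : AddCommGroup (Co M) := inferInstanceAs (AddCommGroup (coSubmodule M))

instance : Module ℂ (Co M) := inferInstanceAs (Module ℂ (coSubmodule M))

/-- The inclusion of the coorbit space into `S_w'`. -/
def incl : Co M →ₗ[ℂ] S.AntiDual := (coSubmodule M).subtype

/-- The norm `‖T‖ = ‖V_e T‖_{L_{r,m}}` of the coorbit space, as a seminorm. (That it is definite
is a theorem about the voice transform, and not a part of the definition.) -/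
def normCo : Seminorm ℂ (Co M) :=
  lpSeminorm μ M.r M.one_lt_r.le (S.weightedExtVoice M.m ∘ₗ incl M) fun T => T.2

instance : SeminormedAddCommGroup (Co M) :=
  (normCo M).toAddGroupSeminorm.toSeminormedAddCommGroup

instance : NormedSpace ℂ (Co M) where
  norm_smul_le c T := (map_smul_eq_mul (normCo M) c T).le

theorem norm_eq (T : Co M) : ‖T‖ = (normLpW μ M.m M.r (S.extVoice (incl M T))).toReal := rfl

/-- The vector `π(x) u` as an element of the coorbit space. -/
def atom (x : G) : Co M :=
  ⟨S.embed (S.π x S.u),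
    S.memLpW_translate M.one_lt_r M.r_lt_top M.m M.m_continuous M.m_pos M.m_mul_le_right x⟩

end Co

/-! ### The conditions on the kernel -/

section Conditions

variable [IsTopologicalGroup G] [LocallyCompactSpace G]

/-- The constant `C_U = max (‖osc_U W‖_{L_{1,w}}, ‖osc_U W‖_{L_{1,w Δ⁻¹}})`. -/
def oscConst (S : CoorbitSetting μ H) (U : Set G) (W : G → ℂ) : ℝ≥0∞ :=
  max (normL1 μ S.w (osc U W)) (normL1 μ (fun x => S.w x * (modularFn x)⁻¹) (osc U W))

/-- The conditions on `(r, m)`: right convolution with `K` is well defined and bounded on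
`L_{r,m}(G)`, and there is a continuous `W` with `W * K = K` whose local maximal function belongs to
`L_{1,w}(G) ∩ L_{1,w Δ⁻¹}(G)` for some compact unit neighbourhood `Q`, and for which
`C_U ‖RC_K‖ < 1`. -/
def Admissible (M : S.Model) (U : Set G) : Prop :=
  BoundedRC μ M.m M.r S.kernel ∧
    ∃ W : G → ℂ, Continuous W ∧
      (Convolvable μ W S.kernel ∧ groupConv μ W S.kernel =ᵐ[μ] S.kernel) ∧
      (∃ Q : Set G, IsCompact Q ∧ Q ∈ 𝓝 (1 : G) ∧
        normL1 μ S.w (maxFun μ Q W) < ⊤ ∧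
        normL1 μ (fun x => S.w x * (modularFn x)⁻¹) (maxFun μ Q W) < ⊤) ∧
      oscConst S U W * normRC μ M.m M.r S.kernel < 1

end Conditions

end Model

end CoorbitSetting

end

/-! The space Co(L_{r,m}) is a retract of L_{r,m}, and the theorem is a discretization of a
convolution carried through this retraction.

The basis is the reproducing formula ⟨T, v⟩ = ∫ V_e T · conj(V v) for T ∈ S_w'
(`integrable_and_eq_integral_extVoice`). The kernel K is not assumed integrable, so the formula
needs an argument. Since V v = V v * K and K ∈ L_{s,w} for every s > 1, Young's inequality bounds
each seminorm of S_w by a constant times any one with a smaller exponent; hence T is bounded by a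
single seminorm with exponent 1 < p < 2. Hahn–Banach and L_p duality then give T a density, and
Fubini, justified by Young's inequality again, replaces the density by V_e T.

By Hölder's inequality and the moderateness of m, every f ∈ L_{r,m} defines a functional `ofFun f`,
namely v ↦ ∫ f conj(V v), whose voice transform is f * K. Thus ‖ofFun f‖ ≤ ‖RC_K‖ ‖f‖, and the
reproducing formula says ofFun (V_e T) = T. It follows that Co(L_{r,m}) is complete with a definite
norm and that its convergence implies pointwise convergence on S_w.

To avoid estimating ∑ c_i K(x_i⁻¹ ·) directly, W * K = K is used to write π(x_i)u = ofFun (W(x_i⁻¹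
·)). The local maximal function of W is integrable with the weights, so ∑ c_i W(x_i⁻¹ ·) is bounded
in L_{r,m} by ‖c‖, and Synth c is `ofFun` of this sum (`exists_synth`).

Put C₀ T = (∫ V_e T ψ_i)_i. Because (V_e T * W) * K = V_e T * K, also T = ofFun (V_e T * W). The
difference between V_e T * W and its discretization ∑ (C₀ T)_i W(x_i⁻¹ ·) is dominated by |V_e T| *
osc_U W. Hence ‖T − Synth C₀ T‖ ≤ C_U ‖RC_K‖ ‖T‖ with a factor below 1; a Neumann series B inverts
Synth C₀, and C₀ B is the coefficient operator.

Neither C₀ nor Synth, as the sum of a series in S_w', involves W or (r, m). So the operators Synth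
C₀ of two admissible models agree on common elements, and so do their Neumann series. -/

noncomputable section

set_option linter.unusedSectionVars false

/-! ### Young's inequality for integral kernels -/

section Young

variable {α β : Type*} [MeasurableSpace α] [MeasurableSpace β]

/-- Pointwise Hölder estimate behind Young's inequality, with `1 + 1 / q = 1 / p + 1 / s`. -/
theorem lintegral_kernel_mul_le {ν : Measure β} {p s q : ℝ} (hp : 1 ≤ p) (hs : 1 ≤ s)
    (hq : 0 < q) (h : 1 + q⁻¹ = p⁻¹ + s⁻¹) {k f : β → ℝ≥0∞}
    (hk : AEMeasurable k ν) (hf : AEMeasurable f ν) :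
    ∫⁻ y, k y * f y ∂ν ≤ (∫⁻ y, k y ^ s * f y ^ p ∂ν) ^ q⁻¹ *
      ((∫⁻ y, k y ^ s ∂ν) ^ (1 - p⁻¹) * (∫⁻ y, f y ^ p ∂ν) ^ (1 - s⁻¹)) := by
  have hp0 : 0 < p := by linarith
  have hs0 : 0 < s := by linarith
  have hp1 : 0 ≤ 1 - p⁻¹ := sub_nonneg.2 (inv_le_one_of_one_le₀ hp)
  have hs1 : 0 ≤ 1 - s⁻¹ := sub_nonneg.2 (inv_le_one_of_one_le₀ hs)
  have hq1 : 0 ≤ q⁻¹ := (inv_pos.2 hq).le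
  -- Hölder's inequality with three factors, for the splitting k f = (k^s f^p)^{1/q} · (k^s)^{1−1/p}
  -- · (f^p)^{1−1/s}. The exponents 1/q, 1−1/p, 1−1/s add up to 1 by `h`.
  have key := ENNReal.lintegral_prod_norm_pow_le (μ := ν) (Finset.univ : Finset (Fin 3))
    (f := ![fun y => k y ^ s * f y ^ p, fun y => k y ^ s, fun y => f y ^ p])
    (p := ![q⁻¹, 1 - p⁻¹, 1 - s⁻¹])
    (by
      intro i _
      fin_cases i
      · exact (hk.pow_const _).mul (hf.pow_const _)
      · exact hk.pow_const _
      · exact hf.pow_const _)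
    (by simp only [Fin.sum_univ_three, Matrix.cons_val]; linarith)
    (by intro i _; fin_cases i <;> assumption)
  simp only [Fin.prod_univ_three, Matrix.cons_val] at key
  rw [← mul_assoc]
  refine le_trans (le_of_eq (lintegral_congr fun y => ?_)) key
  rw [ENNReal.mul_rpow_of_nonneg _ _ hq1, ← ENNReal.rpow_mul, ← ENNReal.rpow_mul,
    ← ENNReal.rpow_mul, ← ENNReal.rpow_mul]
  have e1 : s * q⁻¹ + s * (1 - p⁻¹) = 1 := by
    rw [← mul_add, show q⁻¹ + (1 - p⁻¹) = s⁻¹ by linarith, mul_inv_cancel₀ hs0.ne']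
  have e2 : p * q⁻¹ + p * (1 - s⁻¹) = 1 := by
    rw [← mul_add, show q⁻¹ + (1 - s⁻¹) = p⁻¹ by linarith, mul_inv_cancel₀ hp0.ne']
  calc k y * f y = k y ^ (s * q⁻¹ + s * (1 - p⁻¹)) * f y ^ (p * q⁻¹ + p * (1 - s⁻¹)) := by
        rw [e1, e2, ENNReal.rpow_one, ENNReal.rpow_one]
    _ = _ := by
        rw [ENNReal.rpow_add_of_nonneg _ _ (by positivity) (by positivity),
          ENNReal.rpow_add_of_nonneg _ _ (by positivity) (by positivity)]
        ring

/-- **Young's inequality** for integral kernels, with `1 + 1 / q = 1 / p + 1 / s`. -/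
theorem lintegral_kernel_rpow_le {μ : Measure α} {ν : Measure β} [SFinite μ] [SFinite ν]
    {p s q : ℝ} (hp : 1 ≤ p) (hs : 1 ≤ s) (hq : 0 < q) (h : 1 + q⁻¹ = p⁻¹ + s⁻¹)
    {k : α → β → ℝ≥0∞} (hk : Measurable (Function.uncurry k)) {f : β → ℝ≥0∞}
    (hf : AEMeasurable f ν) {A : ℝ≥0∞} (h1 : ∀ y, ∫⁻ x, k x y ^ s ∂μ ≤ A)
    (h2 : ∀ x, ∫⁻ y, k x y ^ s ∂ν ≤ A) :
    ∫⁻ x, (∫⁻ y, k x y * f y ∂ν) ^ q ∂μ ≤ (A ^ s⁻¹ * (∫⁻ y, f y ^ p ∂ν) ^ p⁻¹) ^ q := by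
  have hp1 : 0 ≤ 1 - p⁻¹ := sub_nonneg.2 (inv_le_one_of_one_le₀ hp)
  have hs1 : 0 ≤ 1 - s⁻¹ := sub_nonneg.2 (inv_le_one_of_one_le₀ hs)
  set N := ∫⁻ y, f y ^ p ∂ν
  have hkx : ∀ x, Measurable (k x) := fun x => hk.comp measurable_prodMk_left
  have hky : ∀ y, Measurable fun x => k x y := fun y => hk.comp measurable_prodMk_right
  have hm : AEMeasurable (Function.uncurry fun x y => k x y ^ s * f y ^ p) (μ.prod ν) :=
    (hk.pow_const s).aemeasurable.mul (hf.pow_const p).comp_snd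
  calc ∫⁻ x, (∫⁻ y, k x y * f y ∂ν) ^ q ∂μ
      ≤ ∫⁻ x, (∫⁻ y, k x y ^ s * f y ^ p ∂ν) *
          (A ^ (1 - p⁻¹) * N ^ (1 - s⁻¹)) ^ q ∂μ := by
        refine lintegral_mono fun x => ?_
        have h3 := lintegral_kernel_mul_le hp hs hq h (hkx x).aemeasurable hf
        calc (∫⁻ y, k x y * f y ∂ν) ^ q
            ≤ ((∫⁻ y, k x y ^ s * f y ^ p ∂ν) ^ q⁻¹ *
              (A ^ (1 - p⁻¹) * N ^ (1 - s⁻¹))) ^ q := by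
              gcongr
              refine h3.trans ?_
              gcongr
              exact h2 x
          _ = _ := by
              rw [ENNReal.mul_rpow_of_nonneg _ _ hq.le, ← ENNReal.rpow_mul,
                inv_mul_cancel₀ hq.ne', ENNReal.rpow_one]
    _ = (∫⁻ x, ∫⁻ y, k x y ^ s * f y ^ p ∂ν ∂μ) * (A ^ (1 - p⁻¹) * N ^ (1 - s⁻¹)) ^ q :=
        lintegral_mul_const'' _ hm.lintegral_prod_right'
    -- Tonelli: integrating first in x costs a factor `A` by `h1`, and what remains is the integral
    -- of f^p.
    _ ≤ (A * N) * (A ^ (1 - p⁻¹) * N ^ (1 - s⁻¹)) ^ q := by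
        gcongr
        rw [lintegral_lintegral_swap hm]
        calc ∫⁻ y, ∫⁻ x, k x y ^ s * f y ^ p ∂μ ∂ν
            = ∫⁻ y, (∫⁻ x, k x y ^ s ∂μ) * f y ^ p ∂ν := by
              refine lintegral_congr fun y => ?_
              rw [lintegral_mul_const _ ((hky y).pow_const s)]
          _ ≤ ∫⁻ y, A * f y ^ p ∂ν := by
              gcongr with y
              exact h1 y
          _ = A * N := lintegral_const_mul'' _ (hf.pow_const p)
    _ = (A ^ s⁻¹ * N ^ p⁻¹) ^ q := by
        have e : (A * N) = ((A ^ q⁻¹) * (N ^ q⁻¹)) ^ q := by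
          rw [ENNReal.mul_rpow_of_nonneg _ _ hq.le, ← ENNReal.rpow_mul, ← ENNReal.rpow_mul,
            inv_mul_cancel₀ hq.ne', ENNReal.rpow_one, ENNReal.rpow_one]
        have e1 : A ^ s⁻¹ = A ^ q⁻¹ * A ^ (1 - p⁻¹) := by
          rw [← ENNReal.rpow_add_of_nonneg _ _ (by positivity) hp1]
          congr 1
          linarith
        have e2 : N ^ p⁻¹ = N ^ q⁻¹ * N ^ (1 - s⁻¹) := by
          rw [← ENNReal.rpow_add_of_nonneg _ _ (by positivity) hs1]
          congr 1
          linarith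
        rw [e, ← ENNReal.mul_rpow_of_nonneg _ _ hq.le, e1, e2, mul_mul_mul_comm]

end Young

/-! ### The modular function and inversion -/

section Inversion

variable {G : Type*} [Group G] [TopologicalSpace G] [IsTopologicalGroup G] [LocallyCompactSpace G]
  [SecondCountableTopology G] [MeasurableSpace G] [BorelSpace G] (μ : Measure G)
  [μ.IsHaarMeasure]

/-- Change of variables `x ↦ x⁻¹` for a left Haar measure. -/
theorem lintegral_inv_eq_modularFn {f : G → ℝ≥0∞} (hf : Measurable f) :
    ∫⁻ x, f x⁻¹ ∂μ = ∫⁻ x, f x * ENNReal.ofReal (modularFn x)⁻¹ ∂μ := by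
  -- Any set `s` of finite nonzero measure would do; its measure is cancelled at the end.
  obtain ⟨K, hK, hK1⟩ := exists_compact_mem_nhds (1 : G)
  set s := interior K
  have hs0 : μ s ≠ 0 :=
    (isOpen_interior.measure_pos μ ⟨1, mem_interior_iff_mem_nhds.2 hK1⟩).ne'
  have hs1 : μ s ≠ ⊤ := ((measure_mono interior_subset).trans_lt hK.measure_lt_top).ne
  have h := measure_mul_lintegral_eq (μ := μ) (ν := μ) isOpen_interior.measurableSet
    (s := s) (fun x => f x⁻¹) (hf.comp measurable_inv)
  simp only [inv_inv] at h
  have h2 : ∀ x : G, μ ((fun z => z * x) ⁻¹' s) = μ s * ENNReal.ofReal (modularFn x)⁻¹ := by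
    intro x
    have h3 := congrArg (fun ν : Measure G => ν s)
      (Measure.map_right_mul_eq_modularCharacterFun_smul μ x)
    rw [Measure.map_apply (measurable_mul_const x) isOpen_interior.measurableSet] at h3
    rw [h3, modularFn, map_inv, NNReal.coe_inv, inv_inv, ENNReal.ofReal_coe_nnreal, mul_comm]
    rfl
  simp only [h2, mul_assoc] at h
  rw [lintegral_const_mul' _ _ hs1] at h
  rw [(ENNReal.mul_right_inj hs0 hs1).1 h]
  exact lintegral_congr fun x => mul_comm _ _

/-- This is the source of the weight w Δ⁻¹: Young's inequality requires the kernel g(y⁻¹x) to be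
integrable in y as well as in x. -/
theorem lintegral_inv_mul_eq_modularFn {f : G → ℝ≥0∞} (hf : Measurable f) (x : G) :
    ∫⁻ y, f (y⁻¹ * x) ∂μ = ∫⁻ y, f y * ENNReal.ofReal (modularFn y)⁻¹ ∂μ := by
  rw [← lintegral_inv_eq_modularFn μ hf, ← lintegral_mul_left_eq_self _ x]
  simp

end Inversion

theorem enorm_complex_ofReal (x : ℝ) : ‖(x : ℂ)‖ₑ = ‖x‖ₑ := by
  rw [← ofReal_norm, ← ofReal_norm, Complex.norm_real]

/-! ### Functionals on `L_p`, `1 ≤ p < 2`, are given by integration -/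

section Representation

variable {α : Type*} [MeasurableSpace α] {μ : Measure α}

/-- A power of a strictly positive integrable function. Such functions serve as multipliers from L_2
into L_p and as truncation levels. -/
theorem exists_pos_memLp [SigmaFinite μ] {p : ℝ≥0∞} (hp0 : p ≠ 0) (hp : p ≠ ⊤) :
    ∃ k : α → ℝ, Measurable k ∧ (∀ x, 0 < k x) ∧ MemLp (fun x => (k x : ℂ)) p μ := by
  obtain ⟨h, h0, hm, hi⟩ := exists_pos_lintegral_lt_of_sigmaFinite μ one_ne_zero
  have hp' : 0 < p.toReal := ENNReal.toReal_pos hp0 hp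
  refine ⟨fun x => (h x : ℝ) ^ p.toReal⁻¹, ?_, fun x => Real.rpow_pos_of_pos (h0 x) _, ?_⟩
  · exact hm.coe_nnreal_real.pow_const _
  · refine ⟨(Complex.measurable_ofReal.comp
      (hm.coe_nnreal_real.pow_const _)).aestronglyMeasurable, ?_⟩
    rw [eLpNorm_lt_top_iff_lintegral_rpow_enorm_lt_top hp0 hp]
    refine lt_of_eq_of_lt (lintegral_congr fun x => ?_) (hi.trans ENNReal.one_lt_top)
    rw [enorm_complex_ofReal]
    beta_reduce
    rw [← NNReal.coe_rpow, Real.enorm_of_nonneg (NNReal.coe_nonneg _), ENNReal.ofReal_coe_nnreal,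
      ← ENNReal.coe_rpow_of_nonneg _ hp'.le,
      ← NNReal.rpow_mul, inv_mul_cancel₀ hp'.ne', NNReal.rpow_one]

theorem tendsto_eLpNorm_sub_indicator {p : ℝ≥0∞} (hp0 : p ≠ 0) (hp : p ≠ ⊤) {F : α → ℂ}
    (hF : MemLp F p μ) {E : ℕ → Set α} (hE : ∀ n, MeasurableSet (E n))
    (hEx : ∀ x, ∀ᶠ n in atTop, x ∈ E n) :
    Tendsto (fun n => eLpNorm ((E n).indicator F - F) p μ) atTop (𝓝 0) := by
  have hp' : 0 < p.toReal := ENNReal.toReal_pos hp0 hp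
  have h1 : Tendsto (fun n => ∫⁻ x, ‖((E n).indicator F - F) x‖ₑ ^ p.toReal ∂μ) atTop
      (𝓝 (∫⁻ _, 0 ∂μ)) := by
    refine tendsto_lintegral_of_dominated_convergence' (fun x => ‖F x‖ₑ ^ p.toReal)
      (fun n => (((hF.1.indicator (hE n)).sub hF.1).enorm.pow_const _))
      (fun n => Eventually.of_forall fun x => ?_)
      (lintegral_rpow_enorm_lt_top_of_eLpNorm_lt_top hp0 hp hF.2).ne
      (Eventually.of_forall fun x => ?_)
    · change ‖((E n).indicator F - F) x‖ₑ ^ p.toReal ≤ ‖F x‖ₑ ^ p.toReal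
      gcongr
      by_cases hx : x ∈ E n <;> simp [hx]
    · refine tendsto_const_nhds.congr' ?_
      filter_upwards [hEx x] with n hn
      simp [hn, hp']
  rw [lintegral_zero] at h1
  simp_rw [eLpNorm_eq_lintegral_rpow_enorm_toReal hp0 hp]
  have := (ENNReal.continuous_rpow_const (y := 1 / p.toReal)).tendsto 0 |>.comp h1
  rwa [ENNReal.zero_rpow_of_pos (by positivity)] at this

/-- The density of a functional on `L_p`, `p < 2`, found by Hilbert space duality. -/
theorem exists_density_of_div_memLp {p : ℝ≥0∞} [Fact (1 ≤ p)]
    (φ : StrongDual ℂ (Lp ℂ p μ)) {s : ℝ≥0∞} (hs : s⁻¹ + 2⁻¹ = p⁻¹) (hs1 : 1 ≤ s)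
    {k : α → ℝ} (hk : ∀ x, 0 < k x)
    (hks : MemLp (fun x => (k x : ℂ)) s μ) (hkm : Measurable k) :
    ∃ g : α → ℂ, Measurable g ∧ ∀ F (hF : MemLp F p μ),
      MemLp (fun x => F x / (k x : ℂ)) 2 μ →
        Integrable (fun x => F x * g x) μ ∧ φ (hF.toLp F) = ∫ x, F x * g x ∂μ := by
  have : ENNReal.HolderTriple s 2 p := ⟨hs⟩
  have : Fact (1 ≤ s) := ⟨hs1⟩
  -- Multiplication by k ∈ L_s maps L_2 into L_p. The Riesz vector `g0` of φ ∘ J satisfies φ(k f) =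
  -- ∫ conj(g0) f, so conj(g0) / k is a density for φ on the functions F = k f.
  let J : Lp ℂ 2 μ →L[ℂ] Lp ℂ p μ :=
    (ContinuousLinearMap.mul ℂ ℂ).holderL μ s 2 p (hks.toLp _)
  let g0 : Lp ℂ 2 μ := (InnerProductSpace.toDual ℂ (Lp ℂ 2 μ)).symm (φ.comp J)
  have hg0 : ∀ f : Lp ℂ 2 μ, inner ℂ g0 f = φ (J f) := fun f =>
    InnerProductSpace.toDual_symm_apply
  have hgm : Measurable g0 := (Lp.stronglyMeasurable g0).measurable
  refine ⟨fun x => (starRingEnd ℂ) (g0 x) / (k x : ℂ), ?_, fun F hF hFk => ?_⟩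
  · exact (Complex.continuous_conj.measurable.comp hgm).div (Complex.measurable_ofReal.comp hkm)
  · have hJ : J (hFk.toLp _) = hF.toLp F := by
      refine Lp.ext ?_
      have h1 := (ContinuousLinearMap.mul ℂ ℂ).coeFn_holder (r := p) (hks.toLp _) (hFk.toLp _)
      filter_upwards [h1, hF.coeFn_toLp, hks.coeFn_toLp, hFk.coeFn_toLp] with x h1 h2 h3 h4
      have h5 : (J (hFk.toLp _)) x = _ := h1
      rw [h5, h2, h3, h4, ContinuousLinearMap.mul_apply']
      have : (k x : ℂ) ≠ 0 := Complex.ofReal_ne_zero.2 (hk x).ne'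
      field_simp
    have hae : (fun x => inner ℂ (g0 x) ((hFk.toLp _ : Lp ℂ 2 μ) x)) =ᵐ[μ]
        fun x => F x * ((starRingEnd ℂ) (g0 x) / (k x : ℂ)) := by
      filter_upwards [hFk.coeFn_toLp] with x h4
      rw [h4, RCLike.inner_apply]
      ring
    constructor
    · exact (L2.integrable_inner g0 (hFk.toLp _)).congr hae
    · rw [← hJ, ← hg0, L2.inner_def]
      exact integral_congr_ae hae

/-- Every continuous functional on `L_p`, `1 ≤ p < 2`, is the integral against a function. -/
theorem exists_density_of_strongDual_Lp [SigmaFinite μ] {p : ℝ≥0∞} [hp1 : Fact (1 ≤ p)]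
    (hp2 : p < 2) (φ : StrongDual ℂ (Lp ℂ p μ)) :
    ∃ g : α → ℂ, Measurable g ∧ ∀ F (hF : MemLp F p μ),
      ∫⁻ x, ‖F x‖ₑ * ‖g x‖ₑ ∂μ ≤ ‖φ‖ₑ * eLpNorm F p μ ∧
        φ (hF.toLp F) = ∫ x, F x * g x ∂μ := by
  have hp0 : p ≠ 0 := (zero_lt_one.trans_le hp1.out).ne'
  have hpt : p ≠ ⊤ := (hp2.trans (by norm_num)).ne
  have hlt : (2 : ℝ≥0∞)⁻¹ < p⁻¹ := ENNReal.inv_lt_inv.2 hp2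
  -- The exponent is finite because p < 2.
  set s : ℝ≥0∞ := (p⁻¹ - 2⁻¹)⁻¹ with hsdef
  have hs : s⁻¹ + 2⁻¹ = p⁻¹ := by rw [hsdef, inv_inv]; exact tsub_add_cancel_of_le hlt.le
  have hs1 : 1 ≤ s := by
    rw [hsdef, ENNReal.one_le_inv]
    exact tsub_le_self.trans (ENNReal.inv_le_one.2 hp1.out)
  have hst : s ≠ ⊤ := by
    rw [hsdef, Ne, ENNReal.inv_eq_top]
    exact (tsub_pos_of_lt hlt).ne'
  obtain ⟨k, hkm, hk, hks⟩ := exists_pos_memLp (μ := μ) (zero_lt_one.trans_le hs1).ne' hst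
  obtain ⟨l, hlm, hl, hl2⟩ := exists_pos_memLp (μ := μ) (p := 2) (by norm_num) (by norm_num)
  obtain ⟨g, hgm, hg⟩ := exists_density_of_div_memLp φ hs hs1 hk hks hkm
  -- Truncation to |F| ≤ n k l with l ∈ L_2 puts F / k into L_2; since k l > 0 the truncation sets
  -- exhaust the space.
  have htrunc : ∀ F : α → ℂ, MemLp F p μ → Measurable F → ∃ E : ℕ → Set α,
      (∀ n, MeasurableSet (E n)) ∧ (∀ x, ∀ᶠ n in atTop, x ∈ E n) ∧
      ∀ n, MemLp (fun x => (E n).indicator F x / (k x : ℂ)) 2 μ := by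
    intro F hF hFm
    have hE : ∀ n : ℕ, MeasurableSet {x | ‖F x‖ ≤ n * (k x * l x)} := fun n =>
      measurableSet_le hFm.norm ((hkm.mul hlm).const_mul _)
    refine ⟨fun n => {x | ‖F x‖ ≤ n * (k x * l x)}, hE, fun x => ?_, fun n => ?_⟩
    · obtain ⟨n, hn⟩ := exists_nat_ge (‖F x‖ / (k x * l x))
      filter_upwards [eventually_ge_atTop n] with j hj
      have hkl : 0 < k x * l x := mul_pos (hk x) (hl x)
      change ‖F x‖ ≤ j * (k x * l x)
      rw [div_le_iff₀ hkl] at hn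
      have : (n : ℝ) ≤ j := by exact_mod_cast hj
      nlinarith
    · refine MemLp.of_le_mul (c := n) hl2 ?_ (Eventually.of_forall fun x => ?_)
      · exact ((hFm.indicator (hE n)).div
          (Complex.measurable_ofReal.comp hkm)).aestronglyMeasurable
      · rw [norm_div, Complex.norm_real, Complex.norm_real, Real.norm_of_nonneg (hk x).le,
          Real.norm_of_nonneg (hl x).le, div_le_iff₀ (hk x)]
        by_cases hx : ‖F x‖ ≤ n * (k x * l x)
        · rw [Set.indicator_of_mem (by exact hx)]
          linarith
        · rw [Set.indicator_of_notMem (by exact hx), norm_zero]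
          have := hk x
          have := hl x
          positivity
  have hbound : ∀ F : α → ℂ, MemLp F p μ → Measurable F →
      ∫⁻ x, ‖F x‖ₑ * ‖g x‖ₑ ∂μ ≤ ‖φ‖ₑ * eLpNorm F p μ := by
    intro F hF hFm
    -- The phase of g is compensated, so that F' = |F| σ satisfies F' g = |F| |g|. Testing φ on
    -- truncations of F' bounds their integrals, and Fatou's lemma removes the truncation.
    let σ : α → ℂ := fun x => (starRingEnd ℂ) (g x) / (‖g x‖ : ℂ)
    have hσm : Measurable σ := (Complex.continuous_conj.measurable.comp hgm).div
      (Complex.measurable_ofReal.comp hgm.norm)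
    have hσ1 : ∀ x, ‖σ x‖ ≤ 1 := by
      intro x
      simp only [σ, norm_div, RCLike.norm_conj, Complex.norm_real, norm_norm]
      exact div_self_le_one _
    have hσg : ∀ x, σ x * g x = (‖g x‖ : ℂ) := by
      intro x
      by_cases hx : g x = 0
      · simp [σ, hx]
      · have : (‖g x‖ : ℂ) ≠ 0 := Complex.ofReal_ne_zero.2 (norm_ne_zero_iff.2 hx)
        simp only [σ]
        field_simp
        rw [Complex.conj_mul']
    let F' : α → ℂ := fun x => (‖F x‖ : ℂ) * σ x
    have hFm' : Measurable F' := (Complex.measurable_ofReal.comp hFm.norm).mul hσm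
    have hle : ∀ x, ‖F' x‖ ≤ ‖F x‖ := by
      intro x
      simp only [F', norm_mul, Complex.norm_real, norm_norm]
      exact mul_le_of_le_one_right (norm_nonneg _) (hσ1 x)
    have hF' : MemLp F' p μ := hF.mono hFm'.aestronglyMeasurable (Eventually.of_forall hle)
    obtain ⟨E, hEm, hEx, hE2⟩ := htrunc F' hF' hFm'
    have hn : ∀ n, ∫⁻ x, ‖(E n).indicator F' x * g x‖ₑ ∂μ ≤ ‖φ‖ₑ * eLpNorm F p μ := by
      intro n
      have hFn : MemLp ((E n).indicator F') p μ := hF'.indicator (hEm n)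
      obtain ⟨hi, he⟩ := hg _ hFn (hE2 n)
      have hpos : ∀ x, (E n).indicator F' x * g x = (‖(E n).indicator F' x * g x‖ : ℂ) := by
        intro x
        by_cases hx : x ∈ E n
        · simp only [Set.indicator_of_mem hx, F', mul_assoc, hσg, norm_mul, Complex.norm_real,
            norm_norm, Complex.ofReal_mul]
        · simp [hx]
      have h1 : ∫⁻ x, ‖(E n).indicator F' x * g x‖ₑ ∂μ = ‖φ (hFn.toLp _)‖ₑ := by
        rw [he, ← ofReal_integral_norm_eq_lintegral_enorm hi, integral_congr_ae
          (Eventually.of_forall hpos), integral_complex_ofReal, enorm_complex_ofReal,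
          Real.enorm_of_nonneg (integral_nonneg fun _ => norm_nonneg _)]
      rw [h1]
      calc ‖φ (hFn.toLp _)‖ₑ ≤ ‖φ‖ₑ * ‖hFn.toLp _‖ₑ := φ.le_opENorm _
        _ = ‖φ‖ₑ * eLpNorm ((E n).indicator F') p μ := by rw [Lp.enorm_toLp]
        _ ≤ ‖φ‖ₑ * eLpNorm F p μ := by
            gcongr
            exact (eLpNorm_indicator_le _).trans (eLpNorm_mono hle)
    have hlim : ∀ x, Tendsto (fun n => ‖(E n).indicator F' x * g x‖ₑ) atTop
        (𝓝 (‖F x‖ₑ * ‖g x‖ₑ)) := by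
      intro x
      refine tendsto_const_nhds.congr' ?_
      filter_upwards [hEx x] with n hn
      rw [Set.indicator_of_mem hn]
      simp only [F', mul_assoc, hσg, enorm_mul, enorm_complex_ofReal, enorm_norm]
    calc ∫⁻ x, ‖F x‖ₑ * ‖g x‖ₑ ∂μ
        = ∫⁻ x, liminf (fun n => ‖(E n).indicator F' x * g x‖ₑ) atTop ∂μ :=
          lintegral_congr fun x => (hlim x).liminf_eq.symm
      _ ≤ liminf (fun n => ∫⁻ x, ‖(E n).indicator F' x * g x‖ₑ ∂μ) atTop :=
          lintegral_liminf_le fun n => ((hFm'.indicator (hEm n)).mul hgm).enorm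
      _ ≤ ‖φ‖ₑ * eLpNorm F p μ := liminf_le_of_le (by isBoundedDefault) fun b hb => by
          obtain ⟨n, hn'⟩ := hb.exists
          exact hn'.trans (hn n)
  -- Both sides pass to the limit along the truncations: the left by continuity of φ, the right by
  -- dominated convergence, with the integrable majorant supplied by `hbound`.
  have hrepr : ∀ F : α → ℂ, ∀ hF : MemLp F p μ, Measurable F →
      φ (hF.toLp F) = ∫ x, F x * g x ∂μ := by
    intro F hF hFm
    obtain ⟨E, hEm, hEx, hE2⟩ := htrunc F hF hFm
    have hFi : Integrable (fun x => F x * g x) μ := by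
      refine ⟨(hFm.mul hgm).aestronglyMeasurable, ?_⟩
      simp only [HasFiniteIntegral, enorm_mul]
      exact (hbound F hF hFm).trans_lt (ENNReal.mul_lt_top enorm_lt_top hF.2)
    have hFn : ∀ n, MemLp ((E n).indicator F) p μ := fun n => hF.indicator (hEm n)
    have h1 : Tendsto (fun n => φ ((hFn n).toLp _)) atTop (𝓝 (φ (hF.toLp F))) := by
      refine (φ.continuous.tendsto _).comp ?_
      rw [Lp.tendsto_Lp_iff_tendsto_eLpNorm'' _ hFn _ hF]
      exact tendsto_eLpNorm_sub_indicator hp0 hpt hF hEm hEx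
    have h2 : Tendsto (fun n => ∫ x, (E n).indicator F x * g x ∂μ) atTop
        (𝓝 (∫ x, F x * g x ∂μ)) := by
      refine tendsto_integral_of_dominated_convergence (fun x => ‖F x * g x‖)
        (fun n => ((hFm.indicator (hEm n)).mul hgm).aestronglyMeasurable) hFi.norm
        (fun n => Eventually.of_forall fun x => ?_) (Eventually.of_forall fun x => ?_)
      · by_cases hx : x ∈ E n <;> simp [hx]
        positivity
      · refine tendsto_const_nhds.congr' ?_
        filter_upwards [hEx x] with n hn
        rw [Set.indicator_of_mem hn]
    refine tendsto_nhds_unique h1 (h2.congr fun n => ?_)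
    exact ((hg _ (hFn n) (hE2 n)).2).symm
  refine ⟨g, hgm, fun F hF => ?_⟩
  have hae := hF.1.ae_eq_mk
  have hFm : Measurable (hF.1.mk F) := hF.1.stronglyMeasurable_mk.measurable
  have hF' : MemLp (hF.1.mk F) p μ := hF.ae_eq hae
  constructor
  · rw [eLpNorm_congr_ae hae]
    refine le_of_eq_of_le (lintegral_congr_ae ?_) (hbound _ hF' hFm)
    filter_upwards [hae] with x hx
    rw [← hx]
  · rw [MemLp.toLp_congr hF hF' hae, hrepr _ hF' hFm]
    refine integral_congr_ae ?_
    filter_upwards [hae] with x hx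
    rw [← hx]

end Representation

/-- A functional that is bounded by the norm of a linear map factors through that map. -/
theorem exists_strongDual_comp_eq {E F : Type*} [AddCommGroup E] [Module ℂ E]
    [NormedAddCommGroup F] [NormedSpace ℂ F] (ι : E →ₗ[ℂ] F) (τ : E →ₗ[ℂ] ℂ) (C : ℝ)
    (h : ∀ v, ‖τ v‖ ≤ C * ‖ι v‖) : ∃ φ : StrongDual ℂ F, ∀ v, φ (ι v) = τ v := by
  -- As `ι` need not be injective, a linear section of its range is chosen; by the bound τ vanishes
  -- on the kernel of `ι`, so τ ∘ σ is the induced functional. Hahn–Banach extends it.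
  obtain ⟨σ, hσ⟩ := ι.rangeRestrict.exists_rightInverse_of_surjective ι.range_rangeRestrict
  have hσ' : ∀ z : ι.range, ι (σ z) = z := fun z =>
    congrArg Subtype.val (LinearMap.congr_fun hσ z)
  let f : StrongDual ℂ ι.range := (τ ∘ₗ σ).mkContinuous C fun z => by
    have := h (σ z)
    rwa [hσ'] at this
  obtain ⟨φ, hφ, -⟩ := exists_extension_norm_eq _ f
  refine ⟨φ, fun v => ?_⟩
  have h1 := hφ ⟨ι v, v, rfl⟩
  change φ (ι v) = τ (σ ⟨ι v, v, rfl⟩) at h1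
  rw [h1, ← sub_eq_zero, ← map_sub, ← norm_le_zero_iff]
  refine (h _).trans_eq ?_
  rw [map_sub, hσ', sub_self, norm_zero, mul_zero]

/-! ### Orthogonality relation, Young's inequality for the kernel, and the reproducing formula on
the anti-dual. -/

namespace CoorbitSetting

section Orthogonality

variable {G : Type*} [Group G] [TopologicalSpace G] [MeasurableSpace G]
  {μ : Measure G} {H : Type*} [NormedAddCommGroup H] [InnerProductSpace ℂ H]
  (S : CoorbitSetting μ H)

theorem kernel_inv (x : G) : S.kernel x⁻¹ = (starRingEnd ℂ) (S.kernel x) := by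
  have h1 : S.π x (S.π x⁻¹ S.u) = S.u := by
    change (S.π x * S.π x⁻¹) S.u = S.u
    rw [← map_mul, mul_inv_cancel, map_one]
    rfl
  simp only [kernel, voice]
  rw [inner_conj_symm, ← (S.π x).inner_map_map, h1]

theorem voice_π_conj (x y : G) :
    S.voice (S.π x S.u) y = (starRingEnd ℂ) (S.voice (S.π y S.u) x) := by
  rw [voice_translate, voice_translate, ← kernel_inv, mul_inv_rev, inv_inv]

variable [BorelSpace G] [SecondCountableTopology G]

theorem memLp_voice (v : H) : MemLp (S.voice v) 2 μ :=
  ⟨(S.voice_continuous v).aestronglyMeasurable, (S.isometry v).trans_lt enorm_lt_top⟩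

/-- The orthogonality relation for voice transforms. -/
theorem integral_conj_voice_mul (a b : H) :
    ∫ x, (starRingEnd ℂ) (S.voice a x) * S.voice b x ∂μ = inner ℂ a b := by
  let V : H →ₗᵢ[ℂ] Lp ℂ 2 μ :=
    { toFun := fun v => (S.memLp_voice v).toLp _
      map_add' := fun a b => by
        rw [← MemLp.toLp_add]
        refine MemLp.toLp_congr _ _ (Eventually.of_forall fun x => ?_)
        simp only [voice, inner_add_right, Pi.add_apply]
      map_smul' := fun c a => by
        rw [RingHom.id_apply, ← MemLp.toLp_const_smul]
        refine MemLp.toLp_congr _ _ (Eventually.of_forall fun x => ?_)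
        simp only [voice, inner_smul_right, Pi.smul_apply, smul_eq_mul]
      norm_map' := fun v => by
        change ‖(S.memLp_voice v).toLp _‖ = ‖v‖
        rw [Lp.norm_toLp, ← toReal_enorm v, ← S.isometry v]
        rfl }
  rw [← V.inner_map_map, L2.inner_def]
  refine integral_congr_ae ?_
  filter_upwards [(S.memLp_voice a).coeFn_toLp, (S.memLp_voice b).coeFn_toLp] with x h1 h2
  change _ = inner ℂ ((S.memLp_voice a).toLp _ x) ((S.memLp_voice b).toLp _ x)
  rw [h1, h2, RCLike.inner_apply, mul_comm]

end Orthogonality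

variable {G : Type*} [Group G] [TopologicalSpace G] [MeasurableSpace G]
  {μ : Measure G} {H : Type*} [NormedAddCommGroup H] [InnerProductSpace ℂ H]

/-- The kernel `w(y⁻¹ x) |K(y⁻¹ x)|`. -/
def absKernel (S : CoorbitSetting μ H) (x y : G) : ℝ≥0∞ :=
  ‖S.weightedVoice S.w S.u (y⁻¹ * x)‖ₑ

variable (S : CoorbitSetting μ H)

theorem enorm_weightedVoice (m : G → ℝ) (hm : ∀ x, 0 < m x) (v : H) (x : G) :
    ‖S.weightedVoice m v x‖ₑ = ENNReal.ofReal (m x) * ‖S.voice v x‖ₑ := by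
  change ‖(m x : ℂ) * S.voice v x‖ₑ = _
  rw [enorm_mul, enorm_complex_ofReal, Real.enorm_of_nonneg (hm x).le]

theorem absKernel_eq (x y : G) :
    S.absKernel x y = ENNReal.ofReal (S.w (y⁻¹ * x)) * ‖S.kernel (y⁻¹ * x)‖ₑ :=
  S.enorm_weightedVoice S.w S.w_pos S.u _

/-- Both w and |K| are invariant under inversion, so the two marginal bounds in Young's inequality
coincide and no modular function appears. -/
theorem absKernel_comm (x y : G) : S.absKernel x y = S.absKernel y x := by
  rw [absKernel_eq, absKernel_eq, S.w_inv (y⁻¹ * x), mul_inv_rev, inv_inv,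
    show y⁻¹ * x = (x⁻¹ * y)⁻¹ by simp, kernel_inv, RCLike.enorm_conj]

variable [IsTopologicalGroup G] [LocallyCompactSpace G] [SecondCountableTopology G]
  [BorelSpace G] [μ.IsHaarMeasure]

theorem measurable_absKernel : Measurable (Function.uncurry S.absKernel) := by
  have h : Continuous (S.weightedVoice S.w S.u) :=
    (Complex.continuous_ofReal.comp S.w_continuous).mul (S.voice_continuous S.u)
  have h2 : Continuous fun z : G × G => S.weightedVoice S.w S.u (z.2⁻¹ * z.1) :=
    h.comp (continuous_snd.inv.mul continuous_fst)
  exact h2.enorm.measurable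

theorem lintegral_absKernel_rpow (s : ℝ) (y : G) :
    ∫⁻ x, S.absKernel x y ^ s ∂μ = ∫⁻ x, ‖S.weightedVoice S.w S.u x‖ₑ ^ s ∂μ :=
  lintegral_mul_left_eq_self (fun x => ‖S.weightedVoice S.w S.u x‖ₑ ^ s) y⁻¹

theorem lintegral_weightedVoice_rpow_lt_top {v : H} (hv : v ∈ S.testSubmodule) {s : ℝ}
    (hs : 1 < s) : ∫⁻ x, ‖S.weightedVoice S.w v x‖ₑ ^ s ∂μ < ⊤ := by
  have h := hv (ENNReal.ofReal s) (by simpa using hs) ENNReal.ofReal_lt_top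
  have := lintegral_rpow_enorm_lt_top_of_eLpNorm_lt_top
    (by simpa using zero_lt_one.trans hs) ENNReal.ofReal_ne_top h.2
  rwa [ENNReal.toReal_ofReal (zero_lt_one.trans hs).le] at this

theorem u_mem_testSubmodule : S.u ∈ S.testSubmodule := fun p hp hp' => S.kernel_mem p hp hp'

theorem continuous_weightedVoice (v : H) : Continuous (S.weightedVoice S.w v) :=
  (Complex.continuous_ofReal.comp S.w_continuous).mul (S.voice_continuous v)

/-- Young's inequality for the convolution with `w |K|`. -/
theorem lintegral_absKernel_mul_rpow_le {p s q : ℝ} (hp : 1 ≤ p) (hs : 1 ≤ s) (hq : 0 < q)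
    (h : 1 + q⁻¹ = p⁻¹ + s⁻¹) {f : G → ℝ≥0∞} (hf : AEMeasurable f μ) :
    ∫⁻ x, (∫⁻ y, S.absKernel x y * f y ∂μ) ^ q ∂μ ≤
      ((∫⁻ x, ‖S.weightedVoice S.w S.u x‖ₑ ^ s ∂μ) ^ s⁻¹ *
        (∫⁻ y, f y ^ p ∂μ) ^ p⁻¹) ^ q := by
  refine lintegral_kernel_rpow_le hp hs hq h S.measurable_absKernel hf
    (fun y => (S.lintegral_absKernel_rpow s y).le) fun x => ?_
  simp_rw [S.absKernel_comm x]
  exact (S.lintegral_absKernel_rpow s x).le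

/-- The orthogonality relation with π(x)u in the first slot is the identity V v = V v * K; the
weight is distributed by w(x) ≤ w(y) w(y⁻¹x). -/
theorem enorm_weightedVoice_le (v : H) (x : G) :
    ‖S.weightedVoice S.w v x‖ₑ ≤
      ∫⁻ y, S.absKernel x y * ‖S.weightedVoice S.w v y‖ₑ ∂μ := by
  have h1 : S.voice v x = ∫ y, (starRingEnd ℂ) (S.voice (S.π x S.u) y) * S.voice v y ∂μ :=
    (S.integral_conj_voice_mul _ _).symm
  rw [S.enorm_weightedVoice _ S.w_pos, h1]
  calc ENNReal.ofReal (S.w x) *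
        ‖∫ y, (starRingEnd ℂ) (S.voice (S.π x S.u) y) * S.voice v y ∂μ‖ₑ
      ≤ ENNReal.ofReal (S.w x) *
        ∫⁻ y, ‖(starRingEnd ℂ) (S.voice (S.π x S.u) y) * S.voice v y‖ₑ ∂μ := by
        gcongr
        exact enorm_integral_le_lintegral_enorm _
    _ = ∫⁻ y, ENNReal.ofReal (S.w x) *
        ‖(starRingEnd ℂ) (S.voice (S.π x S.u) y) * S.voice v y‖ₑ ∂μ :=
        (lintegral_const_mul' _ _ ENNReal.ofReal_ne_top).symm
    _ ≤ _ := by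
        refine lintegral_mono fun y => ?_
        rw [absKernel_eq, S.enorm_weightedVoice _ S.w_pos, enorm_mul, RCLike.enorm_conj,
          voice_π_conj, RCLike.enorm_conj, voice_translate]
        have h2 : ENNReal.ofReal (S.w x) ≤
            ENNReal.ofReal (S.w (y⁻¹ * x)) * ENNReal.ofReal (S.w y) := by
          rw [← ENNReal.ofReal_mul (S.w_pos _).le, mul_comm]
          refine ENNReal.ofReal_le_ofReal ?_
          have := S.w_mul_le y (y⁻¹ * x)
          rwa [mul_inv_cancel_left] at this
        calc _ ≤ (ENNReal.ofReal (S.w (y⁻¹ * x)) * ENNReal.ofReal (S.w y)) *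
              (‖S.kernel (y⁻¹ * x)‖ₑ * ‖S.voice v y‖ₑ) := by gcongr
          _ = _ := by ring

/-- On the test space, the seminorm with the larger exponent is weaker. -/
theorem exists_eLpNorm_weightedVoice_le {p q : ℝ≥0∞} (hp : 1 < p) (hpq : p ≤ q) (hq : q < ⊤) :
    ∃ C : ℝ≥0, ∀ v : H,
      eLpNorm (S.weightedVoice S.w v) q μ ≤ C * eLpNorm (S.weightedVoice S.w v) p μ := by
  rcases hpq.eq_or_lt with rfl | hpq'
  · exact ⟨1, fun v => by simp⟩
  have hpt : p ≠ ⊤ := (hpq'.trans hq).ne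
  set a := p.toReal
  set b := q.toReal
  have ha : 1 < a := by
    rw [← ENNReal.toReal_one]
    exact (ENNReal.toReal_lt_toReal ENNReal.one_ne_top hpt).2 hp
  have hab : a < b := (ENNReal.toReal_lt_toReal hpt hq.ne).2 hpq'
  have hb : 0 < b := by linarith
  have hinv : b⁻¹ < a⁻¹ := inv_strictAnti₀ (by linarith) hab
  have ha1 : a⁻¹ < 1 := inv_lt_one_of_one_lt₀ ha
  have hb1 : 0 < b⁻¹ := inv_pos.2 hb
  -- The exponent that Young's inequality demands. The strict inequality a < b makes s > 1, where K
  -- ∈ L_{s,w} is known; this is why p = q is treated separately.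
  set s : ℝ := (1 + b⁻¹ - a⁻¹)⁻¹ with hsdef
  have hs : 1 < s := (one_lt_inv₀ (by linarith)).2 (by linarith)
  have hA := (S.lintegral_weightedVoice_rpow_lt_top S.u_mem_testSubmodule hs)
  set A := ∫⁻ x, ‖S.weightedVoice S.w S.u x‖ₑ ^ s ∂μ
  have hAs : A ^ s⁻¹ ≠ ⊤ := ENNReal.rpow_ne_top_of_nonneg (by positivity) hA.ne
  refine ⟨(A ^ s⁻¹).toNNReal, fun v => ?_⟩
  rw [ENNReal.coe_toNNReal hAs,
    eLpNorm_eq_lintegral_rpow_enorm_toReal (zero_lt_one.trans (hp.trans hpq')).ne' hq.ne,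
    eLpNorm_eq_lintegral_rpow_enorm_toReal (zero_lt_one.trans hp).ne' hpt, one_div, one_div]
  have h := S.lintegral_absKernel_mul_rpow_le ha.le hs.le hb
    (show 1 + b⁻¹ = a⁻¹ + s⁻¹ by rw [hsdef, inv_inv]; ring)
    (f := fun y => ‖S.weightedVoice S.w v y‖ₑ)
    (S.continuous_weightedVoice v).enorm.measurable.aemeasurable
  calc (∫⁻ x, ‖S.weightedVoice S.w v x‖ₑ ^ b ∂μ) ^ b⁻¹
      ≤ ((A ^ s⁻¹ * (∫⁻ y, ‖S.weightedVoice S.w v y‖ₑ ^ a ∂μ) ^ a⁻¹) ^ b) ^ b⁻¹ := by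
        gcongr
        refine le_trans (lintegral_mono fun x => ?_) h
        gcongr
        exact S.enorm_weightedVoice_le v x
    _ = _ := by rw [← ENNReal.rpow_mul, mul_inv_cancel₀ hb.ne', ENNReal.rpow_one]

/-- A continuous functional on the test space is bounded by a single seminorm with `p < 2`. -/
theorem exists_bound_antiDual (T : S.AntiDual) :
    ∃ p : Set.Ioo (1 : ℝ≥0∞) ⊤, (p : ℝ≥0∞) < 2 ∧ ∃ C : ℝ, ∀ v,
      ‖T v‖ ≤ C * TestSpace.seminorms S p v := by
  obtain ⟨F, C, -, hC⟩ := Seminorm.bound_of_continuous (TestSpace.withSeminorms S)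
    ((normSeminorm ℂ ℂ).comp T.toLinearMap) (T.cont.norm)
  have h32 : (1 : ℝ≥0∞) < 3 / 2 ∧ (3 / 2 : ℝ≥0∞) < 2 := by
    constructor
    · rw [ENNReal.lt_div_iff_mul_lt (by simp) (by simp)]; norm_num
    · rw [ENNReal.div_lt_iff (by simp) (by simp)]; norm_num
  let p₁ : Set.Ioo (1 : ℝ≥0∞) ⊤ := ⟨3 / 2, h32.1, h32.2.trans (by norm_num)⟩
  -- The smallest exponent dominates all seminorms in the finite set `F`; adding 3/2 to the set
  -- forces it below 2.
  obtain ⟨p, hp1, hpF⟩ : ∃ p : Set.Ioo (1 : ℝ≥0∞) ⊤, p ≤ p₁ ∧ ∀ q ∈ F, p ≤ q :=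
    ⟨(insert p₁ F).min' (Finset.insert_nonempty _ _),
      Finset.min'_le _ _ (Finset.mem_insert_self _ _),
      fun q hq => Finset.min'_le _ _ (Finset.mem_insert_of_mem hq)⟩
  have hD : ∀ q : Set.Ioo (1 : ℝ≥0∞) ⊤, ∃ D : ℝ≥0, p ≤ q → ∀ v,
      TestSpace.seminorms S q v ≤ D * TestSpace.seminorms S p v := by
    intro q
    by_cases hpq : p ≤ q
    · obtain ⟨D, hD⟩ := S.exists_eLpNorm_weightedVoice_le p.2.1 hpq q.2.2
      refine ⟨D, fun _ v => ?_⟩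
      have h1 := ENNReal.toReal_mono
        (ENNReal.mul_ne_top ENNReal.coe_ne_top (v.2 p p.2.1 p.2.2).2.ne)
        (hD (TestSpace.incl S v))
      rw [ENNReal.toReal_mul] at h1
      exact h1
    · exact ⟨0, fun h => absurd h hpq⟩
  choose D hD using hD
  refine ⟨p, (show (p : ℝ≥0∞) ≤ 3 / 2 from hp1).trans_lt h32.2, C * ∑ q ∈ F, (D q : ℝ),
    fun v => ?_⟩
  have h1 : ‖T v‖ ≤ C * (F.sup (TestSpace.seminorms S)) v := hC v
  refine h1.trans ?_
  rw [mul_assoc]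
  refine mul_le_mul_of_nonneg_left ?_ C.coe_nonneg
  refine Seminorm.finset_sup_apply_le (by positivity) fun q hq => ?_
  refine (hD q (hpF q hq) v).trans (mul_le_mul_of_nonneg_right ?_ (apply_nonneg _ _))
  exact Finset.single_le_sum (f := fun q => (D q : ℝ)) (fun _ _ => NNReal.coe_nonneg _) hq

/-- A continuous functional on the test space is the integral against a density. -/
theorem exists_density_antiDual (T : S.AntiDual) :
    ∃ p : ℝ≥0∞, 1 < p ∧ p < 2 ∧ ∃ g : G → ℂ, Measurable g ∧
      (∀ F : G → ℂ, MemLp F p μ → ∫⁻ x, ‖F x‖ₑ * ‖g x‖ₑ ∂μ < ⊤) ∧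
      ∀ v : S.TestSpace, T v =
        ∫ x, (S.w x : ℂ) * (starRingEnd ℂ) (g x) *
          (starRingEnd ℂ) (S.voice (TestSpace.incl S v) x) ∂μ := by
  obtain ⟨p, hp2, C, hC⟩ := S.exists_bound_antiDual T
  have : Fact (1 ≤ (p : ℝ≥0∞)) := ⟨p.2.1.le⟩
  have hmem : ∀ v : S.TestSpace, MemLp (S.weightedVoice S.w (TestSpace.incl S v)) p μ :=
    fun v => v.2 p p.2.1 p.2.2
  let ι : S.TestSpace →ₗ[ℂ] Lp ℂ p μ :=
    { toFun := fun v => (hmem v).toLp _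
      map_add' := fun a b => by
        rw [← MemLp.toLp_add]
        exact MemLp.toLp_congr _ _ (Eventually.of_forall fun x => by simp only [map_add])
      map_smul' := fun c a => by
        rw [RingHom.id_apply, ← MemLp.toLp_const_smul]
        exact MemLp.toLp_congr _ _ (Eventually.of_forall fun x => by simp only [map_smul]) }
  -- Conjugation makes `T` linear, as required by Hahn–Banach and L_p duality.
  let τ : S.TestSpace →ₗ[ℂ] ℂ :=
    { toFun := fun v => (starRingEnd ℂ) (T v)
      map_add' := fun a b => by rw [map_add, map_add]
      map_smul' := fun c a => by
        rw [map_smulₛₗ, smul_eq_mul, map_mul, Complex.conj_conj, RingHom.id_apply, smul_eq_mul] }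
  obtain ⟨φ, hφ⟩ := exists_strongDual_comp_eq ι τ C fun v => by
    change ‖(starRingEnd ℂ) (T v)‖ ≤ C * ‖(hmem v).toLp _‖
    rw [RCLike.norm_conj, Lp.norm_toLp]
    exact hC v
  obtain ⟨g, hgm, hg⟩ := exists_density_of_strongDual_Lp hp2 φ
  refine ⟨p, p.2.1, hp2, g, hgm, fun F hF => (hg F hF).1.trans_lt
    (ENNReal.mul_lt_top enorm_lt_top hF.2), fun v => ?_⟩
  have h1 : (starRingEnd ℂ) (T v) = φ ((hmem v).toLp _) := (hφ v).symm
  rw [(hg _ (hmem v)).2] at h1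
  rw [← Complex.conj_conj (T v), h1, ← integral_conj]
  refine integral_congr_ae (Eventually.of_forall fun x => ?_)
  change (starRingEnd ℂ) ((S.w x : ℂ) * S.voice (TestSpace.incl S v) x * g x) = _
  simp only [map_mul, Complex.conj_ofReal]
  ring

/-- The reproducing formula `⟨T, v⟩ = ∫ V_e T conj(V v)` on the anti-dual of the test space. -/
theorem integrable_and_eq_integral_extVoice (T : S.AntiDual) (v : S.TestSpace) :
    Integrable (fun x => S.extVoice T x * (starRingEnd ℂ) (S.voice (TestSpace.incl S v) x)) μ ∧
      T v = ∫ x, S.extVoice T x * (starRingEnd ℂ) (S.voice (TestSpace.incl S v) x) ∂μ := by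
  obtain ⟨p, hp1, hp2, g, hgm, hgi, hT⟩ := S.exists_density_antiDual T
  set h := TestSpace.incl S v
  have hpt : p ≠ ⊤ := (hp2.trans (by norm_num)).ne
  set Φ : G → ℂ := fun y => (S.w y : ℂ) * (starRingEnd ℂ) (g y)
  have hΦm : Measurable Φ := (Complex.measurable_ofReal.comp S.w_continuous.measurable).mul
    (Complex.continuous_conj.measurable.comp hgm)
  have hext : ∀ x, S.extVoice T x = ∫ y, Φ y * S.kernel (y⁻¹ * x) ∂μ := by
    intro x
    rw [extVoice, hT]
    refine integral_congr_ae (Eventually.of_forall fun y => ?_)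
    change Φ y * (starRingEnd ℂ) (S.voice (S.π x S.u) y) = _
    rw [← voice_π_conj, voice_translate]
  -- absolute convergence of the double integral
  let Y : G → ℝ≥0∞ := fun y => ∫⁻ x, S.absKernel y x * ‖S.weightedVoice S.w h x‖ₑ ∂μ
  have hYm : Measurable Y := by
    have : Measurable (Function.uncurry fun y x =>
        S.absKernel y x * ‖S.weightedVoice S.w h x‖ₑ) :=
      S.measurable_absKernel.mul
        ((S.continuous_weightedVoice h).enorm.measurable.comp measurable_snd)
    exact this.lintegral_prod_right'
  set a := p.toReal
  have ha : 1 < a := by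
    rw [← ENNReal.toReal_one]
    exact (ENNReal.toReal_lt_toReal ENNReal.one_ne_top hpt).2 hp1
  have ha1 : a⁻¹ < 1 := inv_lt_one_of_one_lt₀ ha
  have ha0 : 0 < a⁻¹ := by positivity
  -- Here 1 + 1/a = 2/s with s > 1, so w|K| and w|V h| both have finite L_s norm and Young's
  -- inequality puts `Y` into L_p, where the density `g` can be paired with it.
  set s : ℝ := ((1 + a⁻¹) / 2)⁻¹ with hsdef
  have hs : 1 < s := (one_lt_inv₀ (by linarith)).2 (by linarith)
  have hYa : ∫⁻ y, Y y ^ a ∂μ < ⊤ := by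
    refine (S.lintegral_absKernel_mul_rpow_le hs.le hs.le (by linarith)
      (show 1 + a⁻¹ = s⁻¹ + s⁻¹ by rw [hsdef, inv_inv]; ring)
      (S.continuous_weightedVoice h).enorm.measurable.aemeasurable).trans_lt ?_
    refine ENNReal.rpow_lt_top_of_nonneg (by linarith) (ENNReal.mul_ne_top ?_ ?_)
    · exact ENNReal.rpow_ne_top_of_nonneg (by positivity)
        (S.lintegral_weightedVoice_rpow_lt_top S.u_mem_testSubmodule hs).ne
    · exact ENNReal.rpow_ne_top_of_nonneg (by positivity)
        (S.lintegral_weightedVoice_rpow_lt_top v.2 hs).ne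
  have hYfin : ∀ᵐ y ∂μ, Y y < ⊤ := by
    filter_upwards [ae_lt_top (hYm.pow_const a) hYa.ne] with y hy
    exact lt_top_iff_ne_top.2 fun h => by simp [h, show 0 < a by linarith] at hy
  have hYp : MemLp (fun y => ((Y y).toReal : ℂ)) p μ := by
    refine ⟨(Complex.measurable_ofReal.comp hYm.ennreal_toReal).aestronglyMeasurable, ?_⟩
    rw [eLpNorm_lt_top_iff_lintegral_rpow_enorm_lt_top (zero_lt_one.trans hp1).ne' hpt]
    refine lt_of_le_of_lt (lintegral_mono fun y => ?_) hYa
    rw [enorm_complex_ofReal, Real.enorm_of_nonneg ENNReal.toReal_nonneg]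
    gcongr
    exact ENNReal.ofReal_toReal_le
  have hYg : ∫⁻ y, Y y * ‖g y‖ₑ ∂μ < ⊤ := by
    refine lt_of_le_of_lt (le_of_eq (lintegral_congr_ae ?_)) (hgi _ hYp)
    filter_upwards [hYfin] with y hy
    rw [enorm_complex_ofReal, Real.enorm_of_nonneg ENNReal.toReal_nonneg,
      ENNReal.ofReal_toReal hy.ne]
  have hmeas : Measurable fun z : G × G =>
      Φ z.2 * S.kernel (z.2⁻¹ * z.1) * (starRingEnd ℂ) (S.voice h z.1) := by
    refine ((hΦm.comp measurable_snd).mul ?_).mul ?_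
    · exact ((S.voice_continuous S.u).comp (continuous_snd.inv.mul continuous_fst)).measurable
    · exact (Complex.continuous_conj.comp ((S.voice_continuous h).comp continuous_fst)).measurable
  have hint : Integrable (fun z : G × G =>
      Φ z.2 * S.kernel (z.2⁻¹ * z.1) * (starRingEnd ℂ) (S.voice h z.1)) (μ.prod μ) := by
    refine ⟨hmeas.aestronglyMeasurable, ?_⟩
    rw [HasFiniteIntegral, lintegral_prod_symm _ hmeas.enorm.aemeasurable]
    refine lt_of_le_of_lt (lintegral_mono fun y => ?_) hYg
    rw [← lintegral_mul_const' _ _ enorm_ne_top]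
    refine lintegral_mono fun x => ?_
    have h2 : ENNReal.ofReal (S.w y) ≤
        ENNReal.ofReal (S.w (x⁻¹ * y)) * ENNReal.ofReal (S.w x) := by
      rw [← ENNReal.ofReal_mul (S.w_pos _).le, mul_comm]
      refine ENNReal.ofReal_le_ofReal ?_
      have := S.w_mul_le x (x⁻¹ * y)
      rwa [mul_inv_cancel_left] at this
    have h3 : ‖S.kernel (y⁻¹ * x)‖ₑ = ‖S.kernel (x⁻¹ * y)‖ₑ := by
      rw [show y⁻¹ * x = (x⁻¹ * y)⁻¹ by simp, kernel_inv, RCLike.enorm_conj]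
    simp only [Φ, enorm_mul, RCLike.enorm_conj, enorm_complex_ofReal,
      Real.enorm_of_nonneg (S.w_pos _).le, h3, absKernel_eq, S.enorm_weightedVoice _ S.w_pos]
    calc _ ≤ (ENNReal.ofReal (S.w (x⁻¹ * y)) * ENNReal.ofReal (S.w x)) * ‖g y‖ₑ *
          ‖S.kernel (x⁻¹ * y)‖ₑ * ‖S.voice h x‖ₑ := by gcongr
      _ = _ := by ring
  have hx : ∀ x, ∫ y, Φ y * S.kernel (y⁻¹ * x) * (starRingEnd ℂ) (S.voice h x) ∂μ =
      S.extVoice T x * (starRingEnd ℂ) (S.voice h x) := by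
    intro x
    rw [hext, integral_mul_const]
  constructor
  · refine hint.integral_prod_left.congr (Eventually.of_forall fun x => hx x)
  · rw [← integral_congr_ae (Eventually.of_forall hx), integral_integral_swap hint, hT]
    refine integral_congr_ae (Eventually.of_forall fun y => ?_)
    change Φ y * _ = _
    simp only [mul_assoc]
    rw [integral_const_mul]
    congr 1
    -- After Fubini the inner integral over x is the orthogonality relation for h and π(y)u, which
    -- returns conj(V h(y)).
    have h1 := S.integral_conj_voice_mul h (S.π y S.u)
    rw [voice, inner_conj_symm, ← h1]
    refine integral_congr_ae (Eventually.of_forall fun x => ?_)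
    change (starRingEnd ℂ) (S.voice h x) * S.voice (S.π y S.u) x =
      S.kernel (y⁻¹ * x) * (starRingEnd ℂ) (S.voice h x)
    rw [voice_translate, mul_comm]

end CoorbitSetting

/-! ### The coorbit space as a retract of L_{r,m}. -/

/-- The operator norm `normRC` is attained as a bound. -/
theorem normLpW_groupConv_le {G : Type*} [Group G] [MeasurableSpace G] {μ : Measure G} {v : G → ℝ}
    {p : ℝ≥0∞} {k : G → ℂ} (h : BoundedRC μ v p k) {f : G → ℂ} (hf : MemLpW μ v p f) :
    normLpW μ v p (groupConv μ f k) ≤ normRC μ v p k * normLpW μ v p f := by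
  have hft : normLpW μ v p f ≠ ⊤ := hf.2.ne
  obtain ⟨c, hc⟩ : {c : ℝ≥0∞ | ∀ f, MemLpW μ v p f →
      normLpW μ v p (groupConv μ f k) ≤ c * normLpW μ v p f}.Nonempty := by
    by_contra hne
    have h2 := h.2
    rw [normRC, Set.not_nonempty_iff_eq_empty.1 hne, sInf_empty] at h2
    exact lt_irrefl _ h2
  -- For ‖f‖ = 0 the infimum cannot be reached by division; any bound `c` then shows that the left
  -- side vanishes.
  by_cases h0 : normLpW μ v p f = 0
  · have := hc f hf
    rw [h0, mul_zero] at this ⊢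
    exact this
  · rw [← ENNReal.div_le_iff h0 hft]
    refine le_sInf fun d hd => ?_
    rw [ENNReal.div_le_iff h0 hft]
    exact hd f hf

namespace CoorbitSetting

namespace Model

section Norm

variable {G : Type*} [Group G] [TopologicalSpace G] [MeasurableSpace G]
  {μ : Measure G} {H : Type*} [NormedAddCommGroup H] [InnerProductSpace ℂ H]
  {S : CoorbitSetting μ H} (M : S.Model)

/-- The norm of `L_{r,m}` for nonnegative functions. -/
def nnNorm (F : G → ℝ≥0∞) : ℝ≥0∞ :=
  (∫⁻ x, (ENNReal.ofReal (M.m x) * F x) ^ M.r.toReal ∂μ) ^ M.r.toReal⁻¹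

theorem one_lt_toReal : 1 < M.r.toReal := by
  rw [← ENNReal.toReal_one]
  exact (ENNReal.toReal_lt_toReal ENNReal.one_ne_top M.r_lt_top.ne).2 M.one_lt_r

theorem toReal_pos : 0 < M.r.toReal := zero_lt_one.trans M.one_lt_toReal

theorem r_ne_zero : M.r ≠ 0 := (zero_lt_one.trans M.one_lt_r).ne'

theorem normLpW_eq_nnNorm (f : G → ℂ) :
    normLpW μ M.m M.r f = M.nnNorm fun x => ‖f x‖ₑ := by
  rw [normLpW, eLpNorm_eq_lintegral_rpow_enorm_toReal M.r_ne_zero M.r_lt_top.ne, nnNorm, one_div]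
  congr 1
  refine lintegral_congr fun x => ?_
  rw [enorm_mul, enorm_complex_ofReal, Real.enorm_of_nonneg (M.m_pos x).le]

theorem nnNorm_mono {F F' : G → ℝ≥0∞} (h : ∀ᵐ x ∂μ, F x ≤ F' x) : M.nnNorm F ≤ M.nnNorm F' := by
  refine ENNReal.rpow_le_rpow (lintegral_mono_ae ?_) (inv_pos.2 M.toReal_pos).le
  filter_upwards [h] with x hx
  exact ENNReal.rpow_le_rpow (by gcongr) M.toReal_pos.le

theorem nnNorm_rpow (F : G → ℝ≥0∞) :
    M.nnNorm F ^ M.r.toReal = ∫⁻ x, (ENNReal.ofReal (M.m x) * F x) ^ M.r.toReal ∂μ := by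
  rw [nnNorm, ← ENNReal.rpow_mul, inv_mul_cancel₀ M.toReal_pos.ne', ENNReal.rpow_one]

variable [BorelSpace G]

theorem memLpW_iff (f : G → ℂ) :
    MemLpW μ M.m M.r f ↔ AEStronglyMeasurable f μ ∧ M.nnNorm (fun x => ‖f x‖ₑ) < ⊤ := by
  rw [← normLpW_eq_nnNorm, MemLpW, MemLp, normLpW]
  refine and_congr_left fun _ => ⟨fun h => ?_, fun h => ?_⟩
  · have hm : Continuous fun x => ((M.m x : ℂ))⁻¹ :=
      (Complex.continuous_ofReal.comp M.m_continuous).inv₀ fun x =>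
        Complex.ofReal_ne_zero.2 (M.m_pos x).ne'
    refine (hm.measurable.aestronglyMeasurable.mul h).congr (Eventually.of_forall fun x => ?_)
    have : (M.m x : ℂ) ≠ 0 := Complex.ofReal_ne_zero.2 (M.m_pos x).ne'
    change (M.m x : ℂ)⁻¹ * ((M.m x : ℂ) * f x) = f x
    rw [inv_mul_cancel_left₀ this]
  · exact (Complex.continuous_ofReal.comp M.m_continuous).measurable.aestronglyMeasurable.mul h

theorem ae_lt_top_of_nnNorm {F : G → ℝ≥0∞} (hF : AEMeasurable F μ) (h : M.nnNorm F < ⊤) :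
    ∀ᵐ x ∂μ, F x < ⊤ := by
  have h1 : ∫⁻ x, (ENNReal.ofReal (M.m x) * F x) ^ M.r.toReal ∂μ ≠ ⊤ := by
    rw [← nnNorm_rpow]
    exact ENNReal.rpow_ne_top_of_nonneg M.toReal_pos.le h.ne
  have h2 : AEMeasurable (fun x => (ENNReal.ofReal (M.m x) * F x) ^ M.r.toReal) μ :=
    (M.m_continuous.measurable.ennreal_ofReal.aemeasurable.mul hF).pow_const _
  filter_upwards [ae_lt_top' h2 h1] with x hx
  refine lt_top_iff_ne_top.2 fun h3 => hx.ne ?_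
  rw [h3, ENNReal.mul_top (by simpa using M.m_pos x), ENNReal.top_rpow_of_pos M.toReal_pos]

/-- The hypothesis on RC_K concerns complex functions; this makes it applicable to extended
nonnegative majorants. -/
theorem memLpW_toReal {F : G → ℝ≥0∞} (hF : AEMeasurable F μ) (h : M.nnNorm F < ⊤) :
    MemLpW μ M.m M.r fun x => ((F x).toReal : ℂ) := by
  refine (M.memLpW_iff _).2
    ⟨(Complex.measurable_ofReal.comp_aemeasurable hF.ennreal_toReal).aestronglyMeasurable, ?_⟩
  refine (M.nnNorm_mono (Eventually.of_forall fun x => ?_)).trans_lt h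
  rw [enorm_complex_ofReal, Real.enorm_of_nonneg ENNReal.toReal_nonneg]
  exact ENNReal.ofReal_toReal_le

/-- Hölder's inequality for the pairing of `L_{r,m}` with voice transforms. -/
theorem lintegral_enorm_mul_voice_le {f : G → ℂ} (hf : AEStronglyMeasurable f μ) (v : H) :
    ∫⁻ x, ‖f x‖ₑ * ‖S.voice v x‖ₑ ∂μ ≤ ENNReal.ofReal (M.m 1)⁻¹ * (normLpW μ M.m M.r f *
      eLpNorm (S.weightedVoice S.w v) (ENNReal.ofReal M.r.toReal.conjExponent) μ) := by
  have hc : M.r.toReal.HolderConjugate M.r.toReal.conjExponent :=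
    Real.HolderConjugate.conjExponent M.one_lt_toReal
  have hm1 := M.m_pos 1
  rw [normLpW_eq_nnNorm, eLpNorm_eq_lintegral_rpow_enorm_toReal
    (by simpa using hc.symm.pos) ENNReal.ofReal_ne_top, ENNReal.toReal_ofReal hc.symm.nonneg,
    nnNorm, ← one_div M.r.toReal]
  calc ∫⁻ x, ‖f x‖ₑ * ‖S.voice v x‖ₑ ∂μ
      ≤ ∫⁻ x, ENNReal.ofReal (M.m 1)⁻¹ *
          (((fun x => ENNReal.ofReal (M.m x) * ‖f x‖ₑ) *
            fun x => ‖S.weightedVoice S.w v x‖ₑ) x) ∂μ := by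
        refine lintegral_mono fun x => ?_
        rw [Pi.mul_apply, S.enorm_weightedVoice _ S.w_pos]
        -- From m(1) = m(x x⁻¹) ≤ m(x) w(x⁻¹) = m(x) w(x): the weight of the dual of L_{r,m} is
        -- dominated by w, which is what the test space provides.
        have h1 : 1 ≤ ENNReal.ofReal (M.m 1)⁻¹ *
            (ENNReal.ofReal (M.m x) * ENNReal.ofReal (S.w x)) := by
          rw [← ENNReal.ofReal_mul (M.m_pos x).le, ← ENNReal.ofReal_mul (inv_pos.2 hm1).le,
            ENNReal.one_le_ofReal, ← div_eq_inv_mul, one_le_div hm1]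
          have := M.m_mul_le_right x x⁻¹
          rwa [mul_inv_cancel, ← S.w_inv] at this
        calc ‖f x‖ₑ * ‖S.voice v x‖ₑ
            = 1 * (‖f x‖ₑ * ‖S.voice v x‖ₑ) := (one_mul _).symm
          _ ≤ (ENNReal.ofReal (M.m 1)⁻¹ *
            (ENNReal.ofReal (M.m x) * ENNReal.ofReal (S.w x))) *
              (‖f x‖ₑ * ‖S.voice v x‖ₑ) := by gcongr
          _ = _ := by ring
    _ = ENNReal.ofReal (M.m 1)⁻¹ * ∫⁻ x, ((fun x => ENNReal.ofReal (M.m x) * ‖f x‖ₑ) *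
            fun x => ‖S.weightedVoice S.w v x‖ₑ) x ∂μ :=
        lintegral_const_mul' _ _ ENNReal.ofReal_ne_top
    _ ≤ _ := by
        gcongr
        exact ENNReal.lintegral_mul_le_Lp_mul_Lq μ hc
          (M.m_continuous.measurable.ennreal_ofReal.aemeasurable.mul hf.enorm)
          (((Complex.continuous_ofReal.comp S.w_continuous).mul
            (S.voice_continuous v)).enorm.measurable.aemeasurable)

theorem conjExponent_mem :
    ENNReal.ofReal M.r.toReal.conjExponent ∈ Set.Ioo (1 : ℝ≥0∞) ⊤ := by
  have hc : M.r.toReal.HolderConjugate M.r.toReal.conjExponent :=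
    Real.HolderConjugate.conjExponent M.one_lt_toReal
  exact ⟨by simpa using hc.symm.lt, ENNReal.ofReal_lt_top⟩

/-- The constant in the pairing of `L_{r,m}` with a test vector. -/
def pairingConst (v : S.TestSpace) : ℝ :=
  (M.m 1)⁻¹ * TestSpace.seminorms S ⟨_, M.conjExponent_mem⟩ v

theorem pairing_bound_ne_top {f : G → ℂ} (hf : MemLpW μ M.m M.r f) (v : S.TestSpace) :
    ENNReal.ofReal (M.m 1)⁻¹ * (normLpW μ M.m M.r f * eLpNorm
      (S.weightedVoice S.w (TestSpace.incl S v)) (ENNReal.ofReal M.r.toReal.conjExponent) μ)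
      ≠ ⊤ := by
  have h := (v.2 _ M.conjExponent_mem.1 M.conjExponent_mem.2).2.ne
  exact ENNReal.mul_ne_top ENNReal.ofReal_ne_top (ENNReal.mul_ne_top hf.2.ne h)

theorem integrable_mul_conj_voice {f : G → ℂ} (hf : MemLpW μ M.m M.r f) (v : S.TestSpace) :
    Integrable (fun x => f x * (starRingEnd ℂ) (S.voice (TestSpace.incl S v) x)) μ := by
  have hfm := ((M.memLpW_iff f).1 hf).1
  refine ⟨hfm.mul ((Complex.continuous_conj.comp
    (S.voice_continuous _)).measurable.aestronglyMeasurable), ?_⟩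
  simp only [HasFiniteIntegral, enorm_mul, RCLike.enorm_conj]
  exact (M.lintegral_enorm_mul_voice_le hfm _).trans_lt
    (M.pairing_bound_ne_top hf v).lt_top

theorem norm_integral_mul_conj_voice_le {f : G → ℂ} (hf : MemLpW μ M.m M.r f) (v : S.TestSpace) :
    ‖∫ x, f x * (starRingEnd ℂ) (S.voice (TestSpace.incl S v) x) ∂μ‖ ≤
      (normLpW μ M.m M.r f).toReal * M.pairingConst v := by
  have hfm := ((M.memLpW_iff f).1 hf).1
  have h1 : ‖∫ x, f x * (starRingEnd ℂ) (S.voice (TestSpace.incl S v) x) ∂μ‖ₑ ≤ _ :=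
    (enorm_integral_le_lintegral_enorm _).trans (le_trans (le_of_eq (lintegral_congr fun x => by
      rw [enorm_mul, RCLike.enorm_conj])) (M.lintegral_enorm_mul_voice_le hfm _))
  have h2 := ENNReal.toReal_mono (M.pairing_bound_ne_top hf v) h1
  rw [toReal_enorm, ENNReal.toReal_mul, ENNReal.toReal_mul,
    ENNReal.toReal_ofReal (inv_pos.2 (M.m_pos 1)).le] at h2
  refine h2.trans_eq ?_
  rw [pairingConst]
  change _ = _ * (_ * (eLpNorm (S.weightedVoice S.w (TestSpace.incl S v)) _ μ).toReal)
  ring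

/-- The functional `v ↦ ∫ f conj(V v)` for `f ∈ L_{r,m}`. -/
def antiDualOfFun (f : G → ℂ) (hf : MemLpW μ M.m M.r f) : S.AntiDual :=
  let T : S.TestSpace →ₛₗ[starRingEnd ℂ] ℂ :=
    { toFun := fun v => ∫ x, f x * (starRingEnd ℂ) (S.voice (TestSpace.incl S v) x) ∂μ
      map_add' := fun a b => by
        rw [← integral_add (M.integrable_mul_conj_voice hf a) (M.integrable_mul_conj_voice hf b)]
        refine integral_congr_ae (Eventually.of_forall fun x => ?_)
        simp only [map_add, voice, inner_add_right, mul_add]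
      map_smul' := fun c a => by
        rw [smul_eq_mul, ← integral_const_mul]
        refine integral_congr_ae (Eventually.of_forall fun x => ?_)
        simp only [map_smul, voice, inner_smul_right, map_mul]
        ring }
  ⟨T, by
    refine (TestSpace.withSeminorms S).continuous_normedSpace_rng ℂ T
      ⟨{⟨_, M.conjExponent_mem⟩},
        ((normLpW μ M.m M.r f).toReal * (M.m 1)⁻¹).toNNReal, fun v => ?_⟩
    change ‖T v‖ ≤ _
    rw [Finset.sup_singleton]
    change _ ≤ (((normLpW μ M.m M.r f).toReal * (M.m 1)⁻¹).toNNReal : ℝ) *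
      TestSpace.seminorms S _ v
    rw [Real.coe_toNNReal _ (mul_nonneg ENNReal.toReal_nonneg (inv_pos.2 (M.m_pos 1)).le),
      mul_assoc]
    exact M.norm_integral_mul_conj_voice_le hf v⟩

theorem antiDualOfFun_apply {f : G → ℂ} (hf : MemLpW μ M.m M.r f) (v : S.TestSpace) :
    M.antiDualOfFun f hf v =
      ∫ x, f x * (starRingEnd ℂ) (S.voice (TestSpace.incl S v) x) ∂μ := rfl

end Norm

variable {G : Type*} [Group G] [TopologicalSpace G] [MeasurableSpace G]
  {μ : Measure G} {H : Type*} [NormedAddCommGroup H] [InnerProductSpace ℂ H]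
  {S : CoorbitSetting μ H} (M : S.Model)
  [IsTopologicalGroup G] [LocallyCompactSpace G] [SecondCountableTopology G]
  [BorelSpace G] [μ.IsHaarMeasure]

theorem extVoice_antiDualOfFun {f : G → ℂ} (hf : MemLpW μ M.m M.r f) :
    S.extVoice (M.antiDualOfFun f hf) = groupConv μ f S.kernel := by
  funext x
  rw [extVoice, antiDualOfFun_apply, groupConv]
  refine integral_congr_ae (Eventually.of_forall fun y => ?_)
  change f y * (starRingEnd ℂ) (S.voice (S.π x S.u) y) = _
  rw [← voice_π_conj, voice_translate]

theorem enorm_co (T : M.Co) : ‖T‖ₑ = normLpW μ M.m M.r (S.extVoice (M.incl T)) := by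
  rw [← ofReal_norm, norm_eq]
  exact ENNReal.ofReal_toReal T.2.2.ne

theorem co_ext {T₁ T₂ : M.Co} (h : ∀ v, M.incl T₁ v = M.incl T₂ v) : T₁ = T₂ :=
  Subtype.ext (ContinuousLinearMap.ext h)

/-- Evaluation at a test vector is continuous on the coorbit space. -/
theorem norm_incl_apply_le (T : M.Co) (v : S.TestSpace) :
    ‖M.incl T v‖ ≤ ‖T‖ * M.pairingConst v := by
  rw [(S.integrable_and_eq_integral_extVoice (M.incl T) v).2, norm_eq]
  exact M.norm_integral_mul_conj_voice_le T.2 v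

/-- By the reproducing formula V_e T determines T, even up to null sets. -/
theorem eq_zero_of_norm_eq_zero (T : M.Co) (hT : ‖T‖ = 0) : T = 0 := by
  refine M.co_ext fun v => ?_
  have := M.norm_incl_apply_le T v
  rw [hT, zero_mul] at this
  rw [norm_le_zero_iff.1 this, map_zero]
  rfl

/-- Limits taken in different coorbit spaces can therefore be compared in S_w'. -/
theorem tendsto_incl_apply {ι : Type*} {l : Filter ι} {t : ι → M.Co} {T : M.Co}
    (h : Tendsto t l (𝓝 T)) (v : S.TestSpace) :
    Tendsto (fun i => M.incl (t i) v) l (𝓝 (M.incl T v)) := by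
  rw [tendsto_iff_norm_sub_tendsto_zero] at h ⊢
  have h2 := h.mul_const (M.pairingConst v)
  rw [zero_mul] at h2
  refine squeeze_zero (fun _ => norm_nonneg _) (fun i => ?_) h2
  have := M.norm_incl_apply_le (t i - T) v
  rwa [map_sub] at this

variable {M} (hM : BoundedRC μ M.m M.r S.kernel)

/-- The element `v ↦ ∫ f conj(V v)` of the coorbit space, for `f ∈ L_{r,m}`. -/
def ofFun (f : G → ℂ) (hf : MemLpW μ M.m M.r f) : M.Co :=
  ⟨M.antiDualOfFun f hf, by
    change MemLpW μ M.m M.r (S.extVoice _)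
    rw [extVoice_antiDualOfFun]
    exact (hM.1 f hf).2⟩

theorem extVoice_ofFun {f : G → ℂ} (hf : MemLpW μ M.m M.r f) :
    S.extVoice (M.incl (ofFun hM f hf)) = groupConv μ f S.kernel :=
  M.extVoice_antiDualOfFun hf

theorem incl_ofFun_apply {f : G → ℂ} (hf : MemLpW μ M.m M.r f) (v : S.TestSpace) :
    M.incl (ofFun hM f hf) v =
      ∫ x, f x * (starRingEnd ℂ) (S.voice (TestSpace.incl S v) x) ∂μ := rfl

theorem enorm_ofFun_le {f : G → ℂ} (hf : MemLpW μ M.m M.r f) :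
    ‖ofFun hM f hf‖ₑ ≤ normRC μ M.m M.r S.kernel * normLpW μ M.m M.r f := by
  rw [enorm_co, extVoice_ofFun]
  exact normLpW_groupConv_le hM hf

/-- This is the reproducing formula, read as a left inverse of V_e; together with `enorm_ofFun_le`
it exhibits the coorbit space as a retract. -/
theorem ofFun_extVoice (T : M.Co) : ofFun hM (S.extVoice (M.incl T)) T.2 = T :=
  M.co_ext fun v => (S.integrable_and_eq_integral_extVoice (M.incl T) v).2.symm

theorem ofFun_congr_ae {f g : G → ℂ} (hf : MemLpW μ M.m M.r f) (hg : MemLpW μ M.m M.r g)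
    (h : f =ᵐ[μ] g) : ofFun hM f hf = ofFun hM g hg := by
  refine M.co_ext fun v => ?_
  rw [incl_ofFun_apply, incl_ofFun_apply]
  refine integral_congr_ae ?_
  filter_upwards [h] with x hx
  rw [hx]

theorem eq_of_extVoice_ae_eq {T₁ T₂ : M.Co}
    (h : S.extVoice (M.incl T₁) =ᵐ[μ] S.extVoice (M.incl T₂)) : T₁ = T₂ := by
  refine M.co_ext fun v => ?_
  rw [(S.integrable_and_eq_integral_extVoice (M.incl T₁) v).2,
    (S.integrable_and_eq_integral_extVoice (M.incl T₂) v).2]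
  refine integral_congr_ae ?_
  filter_upwards [h] with x hx
  rw [hx]

theorem ofFun_add {f g : G → ℂ} (hf : MemLpW μ M.m M.r f) (hg : MemLpW μ M.m M.r g)
    (hfg : MemLpW μ M.m M.r (f + g)) :
    ofFun hM (f + g) hfg = ofFun hM f hf + ofFun hM g hg := by
  refine M.co_ext fun v => ?_
  rw [map_add]
  change _ = M.incl (ofFun hM f hf) v + M.incl (ofFun hM g hg) v
  rw [incl_ofFun_apply, incl_ofFun_apply, incl_ofFun_apply,
    ← integral_add (M.integrable_mul_conj_voice hf v) (M.integrable_mul_conj_voice hg v)]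
  refine integral_congr_ae (Eventually.of_forall fun x => ?_)
  exact add_mul _ _ _

theorem ofFun_smul (c : ℂ) {f : G → ℂ} (hf : MemLpW μ M.m M.r f)
    (hcf : MemLpW μ M.m M.r (c • f)) : ofFun hM (c • f) hcf = c • ofFun hM f hf := by
  refine M.co_ext fun v => ?_
  rw [map_smul]
  change _ = c * M.incl (ofFun hM f hf) v
  rw [incl_ofFun_apply, incl_ofFun_apply, ← integral_const_mul]
  refine integral_congr_ae (Eventually.of_forall fun x => ?_)
  exact mul_assoc _ _ _

theorem ofFun_sub {f g : G → ℂ} (hf : MemLpW μ M.m M.r f) (hg : MemLpW μ M.m M.r g)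
    (hfg : MemLpW μ M.m M.r (f - g)) :
    ofFun hM (f - g) hfg = ofFun hM f hf - ofFun hM g hg := by
  rw [eq_sub_iff_add_eq, ← ofFun_add hM hfg hg (by rwa [sub_add_cancel])]
  congr 1
  exact sub_add_cancel f g

theorem memLpW_sub {f g : G → ℂ} (hf : MemLpW μ M.m M.r f) (hg : MemLpW μ M.m M.r g) :
    MemLpW μ M.m M.r (f - g) := by
  refine (MemLp.sub hf hg).congr_norm ?_ ?_
  · exact ((Complex.continuous_ofReal.comp M.m_continuous).measurable.aestronglyMeasurable).mul
      (((M.memLpW_iff f).1 hf).1.sub ((M.memLpW_iff g).1 hg).1)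
  · exact Eventually.of_forall fun x => by simp [mul_sub]

/-- V_e is isometric, so the transforms of a Cauchy sequence converge to some f in L_{r,m}.
Continuity of `ofFun` and t_n = ofFun (V_e t_n) make `ofFun f` the limit; that f is itself a voice
transform need not be known. -/
theorem completeSpace_co (hM : BoundedRC μ M.m M.r S.kernel) : CompleteSpace M.Co := by
  have hr : Fact (1 ≤ M.r) := ⟨M.one_lt_r.le⟩
  refine Metric.complete_of_cauchySeq_tendsto fun t ht => ?_
  let Φ : M.Co → Lp ℂ M.r μ := fun T => MemLp.toLp _ T.2
  have hΦ : ∀ T T', Φ (T - T') = Φ T - Φ T' := fun T T' => by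
    refine Eq.trans ?_ (MemLp.toLp_sub T.2 T'.2)
    refine MemLp.toLp_congr _ _ (Eventually.of_forall fun x => ?_)
    exact mul_sub _ _ _
  have hΦn : ∀ T, ‖Φ T‖ = ‖T‖ := fun T => Lp.norm_toLp _ _
  have hc : CauchySeq fun n => Φ (t n) := by
    rw [Metric.cauchySeq_iff] at ht ⊢
    intro ε hε
    obtain ⟨N, hN⟩ := ht ε hε
    refine ⟨N, fun a ha b hb => ?_⟩
    have := hN a ha b hb
    rwa [dist_eq_norm, ← hΦ, hΦn, ← dist_eq_norm]
  obtain ⟨φ, hφ⟩ := cauchySeq_tendsto_of_complete hc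
  have hm0 : ∀ x, (M.m x : ℂ) ≠ 0 := fun x => Complex.ofReal_ne_zero.2 (M.m_pos x).ne'
  let f : G → ℂ := fun x => φ x / (M.m x : ℂ)
  have hmf : (fun x => (M.m x : ℂ) * f x) = φ := by
    funext x
    exact mul_div_cancel₀ _ (hm0 x)
  have hf : MemLpW μ M.m M.r f := by
    rw [MemLpW, hmf]
    exact Lp.memLp φ
  refine ⟨ofFun hM f hf, ?_⟩
  rw [tendsto_iff_edist_tendsto_0] at hφ ⊢
  have h2 := ENNReal.Tendsto.const_mul hφ (Or.inr hM.2.ne)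
  rw [mul_zero] at h2
  refine tendsto_of_tendsto_of_tendsto_of_le_of_le tendsto_const_nhds h2 (fun _ => zero_le)
    fun n => ?_
  have hsub := memLpW_sub (t n).2 hf
  have h3 : t n - ofFun hM f hf = ofFun hM _ hsub := by
    rw [ofFun_sub hM (t n).2 hf]
    congr 1
    exact (ofFun_extVoice hM (t n)).symm
  change edist (t n) (ofFun hM f hf) ≤ normRC μ M.m M.r S.kernel * edist (Φ (t n)) φ
  rw [edist_eq_enorm_sub, h3]
  refine (enorm_ofFun_le hM hsub).trans_eq ?_
  congr 1
  rw [edist_eq_enorm_sub, Lp.enorm_def, normLpW]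
  refine eLpNorm_congr_ae ?_
  filter_upwards [Lp.coeFn_sub (Φ (t n)) φ, MemLp.coeFn_toLp (t n).2] with x h4 h5
  have h6 : Φ (t n) x = (M.m x : ℂ) * S.extVoice (M.incl (t n)) x := h5
  refine Eq.trans ?_ h4.symm
  change _ = Φ (t n) x - φ x
  rw [h6, ← congrFun hmf x]
  exact mul_sub _ _ _

end Model

end CoorbitSetting

/-! ### Pointwise local maximal functions and oscillations. -/

section SupFun

variable {G : Type*} [Group G] [TopologicalSpace G] [IsTopologicalGroup G]

/-- The pointwise local maximal function `x ↦ sup_{q ∈ V} |f(q x)|`. -/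
def supFun (V : Set G) (f : G → ℂ) (x : G) : ℝ≥0∞ :=
  ⨆ q ∈ V, ‖f (q * x)‖ₑ

theorem enorm_le_supFun {V : Set G} (f : G → ℂ) {q : G} (hq : q ∈ V) (x : G) :
    ‖f (q * x)‖ₑ ≤ supFun V f x :=
  le_iSup₂ (f := fun q (_ : q ∈ V) => ‖f (q * x)‖ₑ) q hq

variable [MeasurableSpace G] [BorelSpace G]

/-- A supremum of continuous functions is lower semicontinuous, however many there are. -/
theorem measurable_supFun (V : Set G) {f : G → ℂ} (hf : Continuous f) :
    Measurable (supFun V f) := by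
  refine LowerSemicontinuous.measurable ?_
  exact lowerSemicontinuous_biSup fun q _ =>
    ((hf.comp (continuous_const_mul q)).enorm).lowerSemicontinuous

theorem measurable_osc (U : Set G) {f : G → ℂ} (hf : Continuous f) :
    Measurable (osc U f) := by
  refine LowerSemicontinuous.measurable ?_
  exact lowerSemicontinuous_biSup fun q _ =>
    (((hf.comp (continuous_const_mul q)).sub hf).enorm).lowerSemicontinuous

/-- If |f| exceeded its essential supremum over Qx at some point of the open set (interior Q)x, then
by continuity it would do so on a nonempty open set, which has positive measure. -/
theorem supFun_interior_le_maxFun (μ : Measure G) [μ.IsOpenPosMeasure] (Q : Set G) {f : G → ℂ}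
    (hf : Continuous f) (x : G) : supFun (interior Q) f x ≤ maxFun μ Q f x := by
  refine iSup₂_le fun q hq => ?_
  by_contra hlt
  rw [not_le] at hlt
  set V : Set G := (fun q => q * x) '' interior Q
  have hV : IsOpen V := isOpenMap_mul_right x _ isOpen_interior
  set O : Set G := V ∩ {y | maxFun μ Q f x < ‖f y‖ₑ}
  have hO : IsOpen O := hV.inter (isOpen_lt continuous_const hf.enorm)
  have hpos : 0 < μ O := hO.measure_pos μ ⟨q * x, ⟨q, hq, rfl⟩, hlt⟩
  have h1 : ∀ᵐ y ∂(μ.restrict ((fun q => q * x) '' Q)), ‖f y‖ₑ ≤ maxFun μ Q f x := by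
    have := ae_le_eLpNormEssSup (f := f) (μ := μ.restrict ((fun q => q * x) '' Q))
    rwa [← eLpNorm_exponent_top] at this
  have h2 : ∀ᵐ y ∂(μ.restrict O), ‖f y‖ₑ ≤ maxFun μ Q f x :=
    ae_restrict_of_ae_restrict_of_subset
      (Set.inter_subset_left.trans (Set.image_mono interior_subset)) h1
  rw [ae_restrict_iff' hO.measurableSet] at h2
  refine hpos.ne' (measure_mono_null (fun y hy => ?_) h2)
  intro h3
  exact (h3 hy).not_gt hy.2

theorem normL1_mono (μ : Measure G) (v : G → ℝ) {F F' : G → ℝ≥0∞} (h : ∀ x, F x ≤ F' x) :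
    normL1 μ v F ≤ normL1 μ v F' :=
  lintegral_mono fun x => mul_le_mul_left (h x) _

end SupFun

/-! ### Convolution of L_{r,m} with L_{1,w} ∩ L_{1,wΔ⁻¹}. -/

namespace CoorbitSetting

namespace Model

variable {G : Type*} [Group G] [TopologicalSpace G] [MeasurableSpace G]
  {μ : Measure G} {H : Type*} [NormedAddCommGroup H] [InnerProductSpace ℂ H]
  {S : CoorbitSetting μ H} (M : S.Model)
  [IsTopologicalGroup G] [LocallyCompactSpace G] [SecondCountableTopology G]
  [BorelSpace G] [μ.IsHaarMeasure]

/-- The larger of the norms of `g` in `L_{1,w}` and in `L_{1,w Δ⁻¹}`. -/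
def maxL1 (S : CoorbitSetting μ H) (g : G → ℝ≥0∞) : ℝ≥0∞ :=
  max (normL1 μ S.w g) (normL1 μ (fun x => S.w x * (modularFn x)⁻¹) g)

/-- Young's inequality for the weighted spaces `L_{r,m}`. -/
theorem nnNorm_conv_le {F : G → ℝ≥0∞} (hF : AEMeasurable F μ) {g : G → ℝ≥0∞}
    (hg : Measurable g) :
    M.nnNorm (fun x => ∫⁻ y, F y * g (y⁻¹ * x) ∂μ) ≤ maxL1 S g * M.nnNorm F := by
  set wg : G → ℝ≥0∞ := fun z => g z * ENNReal.ofReal (S.w z)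
  have hwg : Measurable wg := hg.mul S.w_continuous.measurable.ennreal_ofReal
  have hk : Measurable (Function.uncurry fun x y : G => wg (y⁻¹ * x)) :=
    hwg.comp (continuous_snd.inv.mul continuous_fst).measurable
  -- The case s = 1, p = q = r (Schur's test). The two marginals of the kernel (w g)(y⁻¹x) are the
  -- two norms in `maxL1`.
  have h := lintegral_kernel_rpow_le (μ := μ) (ν := μ) M.one_lt_toReal.le le_rfl M.toReal_pos
    (show 1 + M.r.toReal⁻¹ = M.r.toReal⁻¹ + 1⁻¹ by rw [inv_one, add_comm]) hk
    (f := fun y => ENNReal.ofReal (M.m y) * F y)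
    (M.m_continuous.measurable.ennreal_ofReal.aemeasurable.mul hF) (A := maxL1 S g)
    (fun y => by
      simp only [ENNReal.rpow_one]
      rw [lintegral_mul_left_eq_self wg y⁻¹]
      exact le_max_left _ _)
    (fun x => by
      simp only [ENNReal.rpow_one]
      rw [lintegral_inv_mul_eq_modularFn μ hwg]
      refine le_trans (le_of_eq (lintegral_congr fun y => ?_)) (le_max_right _ _)
      rw [ENNReal.ofReal_mul (S.w_pos y).le, mul_assoc])
  rw [inv_one, ENNReal.rpow_one] at h
  calc M.nnNorm (fun x => ∫⁻ y, F y * g (y⁻¹ * x) ∂μ)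
      ≤ (∫⁻ x, (∫⁻ y, wg (y⁻¹ * x) * (ENNReal.ofReal (M.m y) * F y) ∂μ) ^ M.r.toReal ∂μ) ^
          M.r.toReal⁻¹ := by
        refine ENNReal.rpow_le_rpow (lintegral_mono fun x => ?_) (inv_pos.2 M.toReal_pos).le
        refine ENNReal.rpow_le_rpow ?_ M.toReal_pos.le
        rw [← lintegral_const_mul' _ _ ENNReal.ofReal_ne_top]
        refine lintegral_mono fun y => ?_
        have h2 : ENNReal.ofReal (M.m x) ≤
            ENNReal.ofReal (M.m y) * ENNReal.ofReal (S.w (y⁻¹ * x)) := by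
          rw [← ENNReal.ofReal_mul (M.m_pos _).le]
          refine ENNReal.ofReal_le_ofReal ?_
          have := M.m_mul_le_right y (y⁻¹ * x)
          rwa [mul_inv_cancel_left] at this
        calc ENNReal.ofReal (M.m x) * (F y * g (y⁻¹ * x))
            ≤ (ENNReal.ofReal (M.m y) * ENNReal.ofReal (S.w (y⁻¹ * x))) *
              (F y * g (y⁻¹ * x)) := by gcongr
          _ = _ := by ring
    _ ≤ ((maxL1 S g * (∫⁻ y, (ENNReal.ofReal (M.m y) * F y) ^ M.r.toReal ∂μ) ^
          M.r.toReal⁻¹) ^ M.r.toReal) ^ M.r.toReal⁻¹ :=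
        ENNReal.rpow_le_rpow h (inv_pos.2 M.toReal_pos).le
    _ = _ := by rw [← ENNReal.rpow_mul, mul_inv_cancel₀ M.toReal_pos.ne', ENNReal.rpow_one]; rfl

theorem aemeasurable_lintegral_mul_translate {F : G → ℝ≥0∞} (hF : AEMeasurable F μ)
    {g : G → ℝ≥0∞} (hg : Measurable g) : AEMeasurable (fun x => ∫⁻ y, F y * g (y⁻¹ * x) ∂μ) μ := by
  have h : AEMeasurable (Function.uncurry fun x y : G => F y * g (y⁻¹ * x)) (μ.prod μ) :=
    hF.comp_snd.mul (hg.comp (continuous_snd.inv.mul continuous_fst).measurable).aemeasurable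
  exact h.lintegral_prod_right'

variable {M}

theorem nnNorm_lt_top {f : G → ℂ} (hf : MemLpW μ M.m M.r f) :
    M.nnNorm (fun x => ‖f x‖ₑ) < ⊤ := ((M.memLpW_iff f).1 hf).2

theorem aestronglyMeasurable_of_memLpW {f : G → ℂ} (hf : MemLpW μ M.m M.r f) :
    AEStronglyMeasurable f μ := ((M.memLpW_iff f).1 hf).1

theorem nnNorm_abs_conv_lt_top {f : G → ℂ} (hf : MemLpW μ M.m M.r f) {W : G → ℂ}
    (hW : Continuous W) (hW1 : maxL1 S (fun x => ‖W x‖ₑ) < ⊤) :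
    M.nnNorm (fun x => ∫⁻ y, ‖f y‖ₑ * ‖W (y⁻¹ * x)‖ₑ ∂μ) < ⊤ :=
  (M.nnNorm_conv_le (aestronglyMeasurable_of_memLpW hf).enorm hW.enorm.measurable).trans_lt
    (ENNReal.mul_lt_top hW1 (nnNorm_lt_top hf))

theorem ae_integrable_conv {f : G → ℂ} (hf : MemLpW μ M.m M.r f) {W : G → ℂ}
    (hW : Continuous W) (hW1 : maxL1 S (fun x => ‖W x‖ₑ) < ⊤) :
    ∀ᵐ x ∂μ, Integrable (fun y => f y * W (y⁻¹ * x)) μ := by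
  have hfm := aestronglyMeasurable_of_memLpW hf
  filter_upwards [M.ae_lt_top_of_nnNorm
    (aemeasurable_lintegral_mul_translate hfm.enorm hW.enorm.measurable)
    (nnNorm_abs_conv_lt_top hf hW hW1)] with x hx
  refine ⟨hfm.mul (hW.comp
    (continuous_inv.mul continuous_const)).measurable.aestronglyMeasurable, ?_⟩
  simpa only [HasFiniteIntegral, enorm_mul] using hx

theorem memLpW_groupConv {f : G → ℂ} (hf : MemLpW μ M.m M.r f) {W : G → ℂ}
    (hW : Continuous W) (hW1 : maxL1 S (fun x => ‖W x‖ₑ) < ⊤) :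
    MemLpW μ M.m M.r (groupConv μ f W) := by
  have hfm := aestronglyMeasurable_of_memLpW hf
  refine (M.memLpW_iff _).2 ⟨?_, ?_⟩
  · have h : AEStronglyMeasurable (Function.uncurry fun x y : G => f y * W (y⁻¹ * x))
        (μ.prod μ) := hfm.comp_snd.mul
      (hW.comp (continuous_snd.inv.mul continuous_fst)).measurable.aestronglyMeasurable
    exact h.integral_prod_right'
  · refine (M.nnNorm_mono (Eventually.of_forall fun x => ?_)).trans_lt
      (nnNorm_abs_conv_lt_top hf hW hW1)
    refine (enorm_integral_le_lintegral_enorm _).trans_eq ?_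
    simp only [enorm_mul]

/-- Associativity of the convolution: `(f * W) * K = f * K` if `W * K = K`. -/
theorem groupConv_groupConv_ae_eq (hM : BoundedRC μ M.m M.r S.kernel) {f : G → ℂ}
    (hf : MemLpW μ M.m M.r f) {W : G → ℂ} (hW : Continuous W)
    (hW1 : maxL1 S (fun x => ‖W x‖ₑ) < ⊤) (hWK : groupConv μ W S.kernel =ᵐ[μ] S.kernel) :
    groupConv μ (groupConv μ f W) S.kernel =ᵐ[μ] groupConv μ f S.kernel := by
  have hfm := aestronglyMeasurable_of_memLpW hf
  have hK : Continuous S.kernel := S.voice_continuous S.u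
  set B : G → ℝ≥0∞ := fun x => ∫⁻ y, ‖f y‖ₑ * ‖W (y⁻¹ * x)‖ₑ ∂μ
  have hBm : AEMeasurable B μ := aemeasurable_lintegral_mul_translate hfm.enorm hW.enorm.measurable
  have hB : M.nnNorm B < ⊤ := nnNorm_abs_conv_lt_top hf hW hW1
  have hBfin := M.ae_lt_top_of_nnNorm hBm hB
  -- The majorant |f| * |W| lies in L_{r,m}, so it is itself convolvable with K. This absolute
  -- convergence justifies Fubini without integrability of K.
  filter_upwards [(hM.1 _ (M.memLpW_toReal hBm hB)).1] with x hx
  have hfin : ∫⁻ z, B z * ‖S.kernel (z⁻¹ * x)‖ₑ ∂μ < ⊤ := by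
    refine lt_of_le_of_lt (le_of_eq (lintegral_congr_ae ?_)) hx.2
    filter_upwards [hBfin] with z hz
    rw [enorm_mul, enorm_complex_ofReal, Real.enorm_of_nonneg ENNReal.toReal_nonneg,
      ENNReal.ofReal_toReal hz.ne]
  have hmeas : AEStronglyMeasurable (fun p : G × G =>
      f p.2 * W (p.2⁻¹ * p.1) * S.kernel (p.1⁻¹ * x)) (μ.prod μ) :=
    (hfm.comp_snd.mul
      (hW.comp (continuous_snd.inv.mul continuous_fst)).measurable.aestronglyMeasurable).mul
      (hK.comp (continuous_fst.inv.mul continuous_const)).measurable.aestronglyMeasurable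
  have hint : Integrable (fun p : G × G =>
      f p.2 * W (p.2⁻¹ * p.1) * S.kernel (p.1⁻¹ * x)) (μ.prod μ) := by
    refine ⟨hmeas, ?_⟩
    rw [HasFiniteIntegral, lintegral_prod _ hmeas.enorm]
    refine lt_of_le_of_lt (le_of_eq (lintegral_congr fun z => ?_)) hfin
    simp only [enorm_mul]
    rw [lintegral_mul_const' _ _ enorm_ne_top]
  -- The map y ↦ y⁻¹x need not preserve the measure, but it is nonsingular, which suffices to
  -- transport W * K = K.
  have hae : ∀ᵐ y ∂μ, groupConv μ W S.kernel (y⁻¹ * x) = S.kernel (y⁻¹ * x) :=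
    ((quasiMeasurePreserving_mul_right μ x).comp (quasiMeasurePreserving_inv μ)).ae hWK
  calc groupConv μ (groupConv μ f W) S.kernel x
      = ∫ z, ∫ y, f y * W (y⁻¹ * z) * S.kernel (z⁻¹ * x) ∂μ ∂μ :=
        integral_congr_ae (Eventually.of_forall fun z => (integral_mul_const _ _).symm)
    _ = ∫ y, ∫ z, f y * W (y⁻¹ * z) * S.kernel (z⁻¹ * x) ∂μ ∂μ := integral_integral_swap hint
    _ = ∫ y, f y * S.kernel (y⁻¹ * x) ∂μ := by
        refine integral_congr_ae ?_
        filter_upwards [hae] with y hy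
        simp only [mul_assoc]
        rw [integral_const_mul, ← hy, groupConv,
          ← integral_mul_left_eq_self (fun z => W (y⁻¹ * z) * S.kernel (z⁻¹ * x)) y]
        simp [mul_assoc]

end Model

end CoorbitSetting

/-! ### Relatively separated families. -/

section Separated

variable {G : Type*} [Group G]

theorem mem_image_mul_left_iff {x y : G} {Q : Set G} :
    y ∈ (fun q => x * q) '' Q ↔ x⁻¹ * y ∈ Q := by
  constructor
  · rintro ⟨q, hq, rfl⟩
    simpa using hq
  · intro h
    exact ⟨_, h, by simp⟩

variable [TopologicalSpace G] [IsTopologicalGroup G]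

/-- Each x_i Q meets a fixed countable dense set, and each point of that set lies in finitely many
x_i Q. -/
theorem IsRelativelySeparated.countable [LocallyCompactSpace G] [SecondCountableTopology G]
    {I : Type*} {X : I → G} (hX : IsRelativelySeparated X) : Countable I := by
  obtain ⟨Q, hQ, hQ1⟩ := exists_compact_mem_nhds (1 : G)
  obtain ⟨N, hN⟩ := hX Q hQ hQ1
  obtain ⟨s, hs, hsd⟩ := TopologicalSpace.exists_countable_dense G
  rw [← Set.countable_univ_iff]
  have hc : (⋃ d ∈ s, {i : I | d ∈ (fun q => X i * q) '' Q}).Countable :=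
    hs.biUnion fun d _ => (Set.finite_of_encard_le_coe (hN d)).countable
  refine hc.mono fun i _ => ?_
  obtain ⟨d, hds, hd⟩ := hsd.exists_mem_open
    (isOpenMap_mul_left (X i) _ (isOpen_interior (s := Q)))
    ⟨X i * 1, 1, mem_interior_iff_mem_nhds.2 hQ1, rfl⟩
  exact Set.mem_biUnion hds (Set.image_mono interior_subset hd)

theorem measure_image_mul_left [MeasurableSpace G] [BorelSpace G] (μ : Measure G)
    [μ.IsMulLeftInvariant] (x : G) (V : Set G) : μ ((fun q => x * q) '' V) = μ V := by
  rw [Set.image_mul_left, measure_preimage_mul]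

theorem tsum_indicator_one {I α : Type*} (E : I → Set α) (x : α) :
    ∑' i, (E i).indicator (fun _ => (1 : ℝ≥0∞)) x = {i | x ∈ E i}.encard := by
  have h : ∀ i, (E i).indicator (fun _ => (1 : ℝ≥0∞)) x =
      {i | x ∈ E i}.indicator (fun _ => 1) i := fun i => rfl
  rw [tsum_congr h, ← tsum_subtype, ENNReal.tsum_const, mul_one]
  rfl

end Separated

/-! ### Weighted sequence spaces and their comparison with L_{r,m}. -/

namespace CoorbitSetting

namespace Model

section Ell

variable {G : Type*} [Group G] [TopologicalSpace G] [MeasurableSpace G]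
  {μ : Measure G} {H : Type*} [NormedAddCommGroup H] [InnerProductSpace ℂ H]
  {S : CoorbitSetting μ H} (M : S.Model) {I : Type*} (X : I → G)

/-- The norm of `ℓ_{r,m_X}` for nonnegative sequences. -/
def ellNorm (a : I → ℝ≥0∞) : ℝ≥0∞ :=
  (∑' i, (ENNReal.ofReal (M.m (X i)) * a i) ^ M.r.toReal) ^ M.r.toReal⁻¹

theorem enorm_weightSeq (c : I → ℂ) (i : I) :
    ‖M.weightSeq X c i‖ₑ = ENNReal.ofReal (M.m (X i)) * ‖c i‖ₑ := by
  change ‖(M.m (X i) : ℂ) * c i‖ₑ = _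
  rw [enorm_mul, enorm_complex_ofReal, Real.enorm_of_nonneg (M.m_pos _).le]

theorem tsum_weightSeq (c : I → ℂ) :
    ∑' i, (ENNReal.ofReal (M.m (X i)) * ‖c i‖ₑ) ^ M.r.toReal =
      ∑' i, ((‖M.weightSeq X c i‖₊ ^ M.r.toReal : ℝ≥0) : ℝ≥0∞) := by
  refine tsum_congr fun i => ?_
  rw [ENNReal.coe_rpow_of_nonneg _ M.toReal_pos.le, ← enorm_eq_nnnorm, enorm_weightSeq]

theorem summable_weightSeq_iff (c : I → ℂ) :
    (Summable fun i => ‖M.weightSeq X c i‖ ^ M.r.toReal) ↔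
      Summable fun i => ‖M.weightSeq X c i‖₊ ^ M.r.toReal := by
  rw [← NNReal.summable_coe]
  simp only [NNReal.coe_rpow, coe_nnnorm]

theorem mem_ell_iff (c : I → ℂ) :
    c ∈ M.ellSubmodule X ↔ M.ellNorm X (fun i => ‖c i‖ₑ) < ⊤ := by
  change Memℓp (E := fun _ : I => ℂ) (M.weightSeq X c) M.r ↔ _
  rw [memℓp_gen_iff M.toReal_pos, summable_weightSeq_iff, ← ENNReal.tsum_coe_ne_top_iff_summable,
    ← tsum_weightSeq, ellNorm, lt_top_iff_ne_top, Ne, Ne, ENNReal.rpow_eq_top_iff_of_pos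
    (inv_pos.2 M.toReal_pos)]

theorem enorm_ell (c : M.Ell X) : ‖c‖ₑ = M.ellNorm X fun i => ‖M.coeffs X c i‖ₑ := by
  have h1 : ‖c‖ = ‖M.toLp X c‖ := rfl
  rw [ellNorm, tsum_weightSeq, ← ofReal_norm, h1, lp.norm_eq_tsum_rpow M.toReal_pos, one_div]
  have h2 : Summable fun i => ‖M.weightSeq X (M.coeffs X c) i‖₊ ^ M.r.toReal :=
    (M.summable_weightSeq_iff X _).1 ((memℓp_gen_iff M.toReal_pos).1 c.2)
  rw [← ENNReal.coe_tsum h2, ← ENNReal.coe_rpow_of_nonneg _ (inv_pos.2 M.toReal_pos).le,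
    ← ENNReal.ofReal_coe_nnreal]
  congr 1
  rw [NNReal.coe_rpow, NNReal.coe_tsum]
  rfl

open Classical in
/-- The sequence with the single entry `a` at `i`. -/
def ellSingle (i : I) (a : ℂ) : M.Ell X :=
  ⟨Pi.single i a, by
    rw [mem_ell_iff, ellNorm]
    refine ENNReal.rpow_lt_top_of_nonneg (inv_pos.2 M.toReal_pos).le ?_
    rw [tsum_eq_single i]
    · exact ENNReal.rpow_ne_top_of_nonneg M.toReal_pos.le
        (ENNReal.mul_ne_top ENNReal.ofReal_ne_top enorm_ne_top)
    · intro j hj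
      rw [Pi.single_eq_of_ne hj, enorm_zero, mul_zero, ENNReal.zero_rpow_of_pos M.toReal_pos]⟩

open Classical in
theorem coeffs_ellSingle (i : I) (a : ℂ) : M.coeffs X (M.ellSingle X i a) = Pi.single i a := rfl

/-- It uses r < ∞, and any bounded operator carries it over to its values: this is the source of
unconditional convergence of the synthesis series. -/
theorem hasSum_ellSingle (c : M.Ell X) :
    HasSum (fun i => M.ellSingle X i (M.coeffs X c i)) c := by
  classical
  have hr : Fact (1 ≤ M.r) := ⟨M.one_lt_r.le⟩
  have h := lp.hasSum_single M.r_lt_top.ne (M.toLp X c)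
  have h1 : ∀ i, lp.single (E := fun _ : I => ℂ) M.r i (M.toLp X c i) =
      M.toLp X (M.ellSingle X i (M.coeffs X c i)) := by
    intro i
    refine lp.ext (funext fun j => ?_)
    change (Pi.single i ((M.m (X i) : ℂ) * M.coeffs X c i) : I → ℂ) j =
      (M.m (X j) : ℂ) * (Pi.single i (M.coeffs X c i) : I → ℂ) j
    by_cases hj : j = i
    · subst hj
      rw [Pi.single_eq_same, Pi.single_eq_same]
    · rw [Pi.single_eq_of_ne hj, Pi.single_eq_of_ne hj, mul_zero]
  simp only [h1] at h
  unfold HasSum at h ⊢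
  rw [tendsto_iff_norm_sub_tendsto_zero] at h ⊢
  refine h.congr fun s => ?_
  rw [← map_sum, ← map_sub]
  rfl

end Ell

variable {G : Type*} [Group G] [TopologicalSpace G] [MeasurableSpace G]
  {μ : Measure G} {H : Type*} [NormedAddCommGroup H] [InnerProductSpace ℂ H]
  {S : CoorbitSetting μ H} (M : S.Model)
  [IsTopologicalGroup G] [LocallyCompactSpace G] [SecondCountableTopology G]
  [BorelSpace G] [μ.IsHaarMeasure] {I : Type*} {X : I → G}

/-- On a translate x_i Q of a compact set the weight m is comparable to m(x_i), uniformly in i. -/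
theorem m_mul_le_of_mem {Q : Set G} {C : ℝ} (hC : ∀ q ∈ Q, S.w q ≤ C) {x y : G}
    (h : x⁻¹ * y ∈ Q) : M.m y ≤ C * M.m x ∧ M.m x ≤ C * M.m y := by
  constructor
  · have h1 := M.m_mul_le_right x (x⁻¹ * y)
    rw [mul_inv_cancel_left] at h1
    nlinarith [hC _ h, M.m_pos x]
  · have h1 := M.m_mul_le_right y (y⁻¹ * x)
    rw [mul_inv_cancel_left, S.w_inv (y⁻¹ * x), mul_inv_rev, inv_inv] at h1
    nlinarith [hC _ h, M.m_pos y]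

theorem measurable_indicator_uncurry [Countable I] [MeasurableSpace I] [MeasurableSingletonClass I]
    {E : I → Set G} (hE : ∀ i, MeasurableSet (E i)) :
    Measurable (Function.uncurry fun (x : G) (i : I) =>
      (E i).indicator (fun _ => (1 : ℝ≥0∞)) x) :=
  measurable_from_prod_countable_left fun i => measurable_const.indicator (hE i)

/-- The norm in `L_{r,m}` of a linear combination of indicator functions of the sets `x_i V`. -/
theorem exists_nnNorm_tsum_indicator_le (hX : IsRelativelySeparated X) {Q : Set G}
    (hQ : IsCompact Q) (hQ1 : Q ∈ 𝓝 (1 : G)) {V : Set G} (hV : MeasurableSet V) (hVQ : V ⊆ Q) :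
    ∃ C : ℝ≥0∞, C < ⊤ ∧ ∀ a : I → ℝ≥0∞,
      M.nnNorm (fun x => ∑' i, a i * ((fun q => X i * q) '' V).indicator (fun _ => 1) x) ≤
        C * M.ellNorm X a := by
  have := hX.countable
  let _ : MeasurableSpace I := ⊤
  obtain ⟨N, hN⟩ := hX Q hQ hQ1
  obtain ⟨w0, hw0⟩ := (hQ.image S.w_continuous).bddAbove
  have hw : ∀ q ∈ Q, S.w q ≤ w0 := fun q hq => hw0 ⟨q, hq, rfl⟩
  have hE : ∀ i, MeasurableSet ((fun q => X i * q) '' V) := fun i => by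
    rw [Set.image_mul_left]
    exact measurable_const_mul _ hV
  set E : I → Set G := fun i => (fun q => X i * q) '' V
  refine ⟨ENNReal.ofReal w0 * max (N : ℝ≥0∞) (μ V), ENNReal.mul_lt_top ENNReal.ofReal_lt_top
    (max_lt (ENNReal.natCast_lt_top N) ((measure_mono hVQ).trans_lt hQ.measure_lt_top)),
    fun a => ?_⟩
  -- Schur's test between I with counting measure and G, for the kernel 1_{x_i V}(x): at most `N`
  -- translates contain a point, and each has measure μ(V).
  have h := lintegral_kernel_rpow_le (μ := μ) (ν := Measure.count) M.one_lt_toReal.le le_rfl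
    M.toReal_pos (show 1 + M.r.toReal⁻¹ = M.r.toReal⁻¹ + 1⁻¹ by rw [inv_one, add_comm])
    (measurable_indicator_uncurry hE)
    (f := fun i => ENNReal.ofReal (M.m (X i)) * a i) (Measurable.of_discrete).aemeasurable
    (A := max (N : ℝ≥0∞) (μ V))
    (fun i => by
      simp only [ENNReal.rpow_one]
      rw [lintegral_indicator_const (hE i), one_mul, measure_image_mul_left]
      exact le_max_right _ _)
    (fun x => by
      simp only [ENNReal.rpow_one]
      rw [lintegral_count, tsum_indicator_one]
      refine le_trans ?_ (le_max_left _ _)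
      have h1 : {i | x ∈ E i}.encard ≤ N :=
        (Set.encard_le_encard (t := {i | x ∈ (fun q => X i * q) '' Q})
          fun i (hi : x ∈ E i) => Set.image_mono (f := fun q => X i * q) hVQ hi).trans (hN x)
      exact_mod_cast h1)
  simp only [inv_one, ENNReal.rpow_one, lintegral_count] at h
  calc M.nnNorm (fun x => ∑' i, a i * (E i).indicator (fun _ => 1) x)
      ≤ (∫⁻ x, (ENNReal.ofReal w0 * ∑' i, (E i).indicator (fun _ => 1) x *
          (ENNReal.ofReal (M.m (X i)) * a i)) ^ M.r.toReal ∂μ) ^ M.r.toReal⁻¹ := by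
        refine ENNReal.rpow_le_rpow (lintegral_mono fun x => ?_) (inv_pos.2 M.toReal_pos).le
        refine ENNReal.rpow_le_rpow ?_ M.toReal_pos.le
        rw [← ENNReal.tsum_mul_left, ← ENNReal.tsum_mul_left]
        refine ENNReal.tsum_le_tsum fun i => ?_
        by_cases hx : x ∈ E i
        · rw [Set.indicator_of_mem hx, mul_one, one_mul, ← mul_assoc]
          gcongr
          rw [mem_image_mul_left_iff] at hx
          have h0 := (M.m_mul_le_of_mem hw (hVQ hx)).1
          have hw00 : 0 ≤ w0 := (S.w_pos _).le.trans (hw _ (hVQ hx))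
          rw [← ENNReal.ofReal_mul hw00]
          exact ENNReal.ofReal_le_ofReal h0
        · rw [Set.indicator_of_notMem hx]
          simp
    _ = ENNReal.ofReal w0 * (∫⁻ x, (∑' i, (E i).indicator (fun _ => 1) x *
          (ENNReal.ofReal (M.m (X i)) * a i)) ^ M.r.toReal ∂μ) ^ M.r.toReal⁻¹ := by
        simp only [ENNReal.mul_rpow_of_nonneg _ _ M.toReal_pos.le]
        rw [lintegral_const_mul' _ _ (ENNReal.rpow_ne_top_of_nonneg M.toReal_pos.le
          ENNReal.ofReal_ne_top), ENNReal.mul_rpow_of_nonneg _ _ (inv_pos.2 M.toReal_pos).le,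
          ← ENNReal.rpow_mul, mul_inv_cancel₀ M.toReal_pos.ne', ENNReal.rpow_one]
    _ ≤ ENNReal.ofReal w0 *
        ((max (N : ℝ≥0∞) (μ V) * M.ellNorm X a) ^ M.r.toReal) ^ M.r.toReal⁻¹ := by
        gcongr
        exact h
    _ = _ := by
        rw [← ENNReal.rpow_mul, mul_inv_cancel₀ M.toReal_pos.ne', ENNReal.rpow_one, mul_assoc]

/-- The `ℓ_{r,m_X}`-norm of the local means of a function in `L_{r,m}`. -/
theorem exists_ellNorm_lintegral_le (hX : IsRelativelySeparated X) {U : Set G}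
    (hU : IsCompact U) (hU1 : U ∈ 𝓝 (1 : G)) (hUm : MeasurableSet U) :
    ∃ C : ℝ≥0∞, C < ⊤ ∧ ∀ F : G → ℝ≥0∞, AEMeasurable F μ →
      M.ellNorm X (fun i => ∫⁻ x, F x * ((fun q => X i * q) '' U).indicator (fun _ => 1) x ∂μ) ≤
        C * M.nnNorm F := by
  have := hX.countable
  let _ : MeasurableSpace I := ⊤
  obtain ⟨N, hN⟩ := hX U hU hU1
  obtain ⟨w0, hw0⟩ := (hU.image S.w_continuous).bddAbove
  have hw : ∀ q ∈ U, S.w q ≤ w0 := fun q hq => hw0 ⟨q, hq, rfl⟩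
  have hE : ∀ i, MeasurableSet ((fun q => X i * q) '' U) := fun i => by
    rw [Set.image_mul_left]
    exact measurable_const_mul _ hUm
  set E : I → Set G := fun i => (fun q => X i * q) '' U
  refine ⟨ENNReal.ofReal w0 * max (N : ℝ≥0∞) (μ U), ENNReal.mul_lt_top ENNReal.ofReal_lt_top
    (max_lt (ENNReal.natCast_lt_top N) hU.measure_lt_top), fun F hF => ?_⟩
  -- Schur's test for the transposed kernel, from functions on G to sequences.
  have h := lintegral_kernel_rpow_le (μ := Measure.count) (ν := μ) M.one_lt_toReal.le le_rfl
    M.toReal_pos (show 1 + M.r.toReal⁻¹ = M.r.toReal⁻¹ + 1⁻¹ by rw [inv_one, add_comm])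
    (k := fun i x => (E i).indicator (fun _ => 1) x)
    ((measurable_indicator_uncurry hE).comp measurable_swap)
    (f := fun x => ENNReal.ofReal (M.m x) * F x)
    (M.m_continuous.measurable.ennreal_ofReal.aemeasurable.mul hF)
    (A := max (N : ℝ≥0∞) (μ U))
    (fun x => by
      simp only [ENNReal.rpow_one]
      rw [lintegral_count, tsum_indicator_one]
      refine le_trans ?_ (le_max_left _ _)
      exact_mod_cast hN x)
    (fun i => by
      simp only [ENNReal.rpow_one]
      rw [lintegral_indicator_const (hE i), one_mul, measure_image_mul_left]
      exact le_max_right _ _)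
  simp only [inv_one, ENNReal.rpow_one, lintegral_count] at h
  calc M.ellNorm X (fun i => ∫⁻ x, F x * (E i).indicator (fun _ => 1) x ∂μ)
      ≤ (∑' i, (ENNReal.ofReal w0 * ∫⁻ x, (E i).indicator (fun _ => 1) x *
          (ENNReal.ofReal (M.m x) * F x) ∂μ) ^ M.r.toReal) ^ M.r.toReal⁻¹ := by
        refine ENNReal.rpow_le_rpow (ENNReal.tsum_le_tsum fun i => ?_) (inv_pos.2 M.toReal_pos).le
        refine ENNReal.rpow_le_rpow ?_ M.toReal_pos.le
        rw [← lintegral_const_mul' _ _ ENNReal.ofReal_ne_top,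
          ← lintegral_const_mul' _ _ ENNReal.ofReal_ne_top]
        refine lintegral_mono fun x => ?_
        by_cases hx : x ∈ E i
        · rw [Set.indicator_of_mem hx, mul_one, one_mul, ← mul_assoc]
          gcongr
          rw [mem_image_mul_left_iff] at hx
          have h0 := (M.m_mul_le_of_mem hw hx).2
          have hw00 : 0 ≤ w0 := (S.w_pos _).le.trans (hw _ hx)
          rw [← ENNReal.ofReal_mul hw00]
          exact ENNReal.ofReal_le_ofReal h0
        · rw [Set.indicator_of_notMem hx]
          simp
    _ = ENNReal.ofReal w0 * (∑' i, (∫⁻ x, (E i).indicator (fun _ => 1) x *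
          (ENNReal.ofReal (M.m x) * F x) ∂μ) ^ M.r.toReal) ^ M.r.toReal⁻¹ := by
        simp only [ENNReal.mul_rpow_of_nonneg _ _ M.toReal_pos.le]
        rw [ENNReal.tsum_mul_left, ENNReal.mul_rpow_of_nonneg _ _ (inv_pos.2 M.toReal_pos).le,
          ← ENNReal.rpow_mul, mul_inv_cancel₀ M.toReal_pos.ne', ENNReal.rpow_one]
    _ ≤ ENNReal.ofReal w0 * ((max (N : ℝ≥0∞) (μ U) * M.nnNorm F) ^ M.r.toReal) ^ M.r.toReal⁻¹ := by
        gcongr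
        exact h
    _ = _ := by
        rw [← ENNReal.rpow_mul, mul_inv_cancel₀ M.toReal_pos.ne', ENNReal.rpow_one, mul_assoc]

end Model

end CoorbitSetting

/-! ### Inversion by a Neumann series. -/

/-- The Neumann series. -/
theorem exists_hasSum_neumann {E : Type*} [SeminormedAddCommGroup E] [NormedSpace ℂ E]
    [CompleteSpace E] (hsep : ∀ x : E, ‖x‖ = 0 → x = 0) (A : E →L[ℂ] E) {q : ℝ} (hq0 : 0 ≤ q)
    (hq : q < 1) (h : ∀ x, ‖x - A x‖ ≤ q * ‖x‖) :
    ∃ B : E →L[ℂ] E, A.comp B = ContinuousLinearMap.id ℂ E ∧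
      ∀ x, HasSum (fun n : ℕ => ((ContinuousLinearMap.id ℂ E - A) ^ n) x) (B x) := by
  -- Definiteness turns the seminorm into a norm, so that the geometric series in the Banach algebra
  -- of operators is available.
  let _ : NormedAddCommGroup E := NormedAddCommGroup.ofSeparation hsep
  set R : E →L[ℂ] E := 1 - A
  have hR : ‖R‖ < 1 := (ContinuousLinearMap.opNorm_le_bound R hq0 h).trans_lt hq
  have hs := summable_geometric_of_norm_lt_one hR
  refine ⟨∑' n : ℕ, R ^ n, ?_, fun x => ?_⟩
  · have h1 := mul_neg_geom_series R hR
    rw [show 1 - R = A from sub_sub_cancel 1 A] at h1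
    exact h1
  · exact (ContinuousLinearMap.apply ℂ E x).hasSum hs.hasSum

/-! ### The synthesis operator. -/

namespace CoorbitSetting

namespace Model

variable {G : Type*} [Group G] [TopologicalSpace G] [MeasurableSpace G]
  {μ : Measure G} {H : Type*} [NormedAddCommGroup H] [InnerProductSpace ℂ H]
  {S : CoorbitSetting μ H} (M : S.Model) {I : Type*} {X : I → G}

theorem nnNorm_const_mul {c : ℝ≥0∞} (hc : c ≠ ⊤) (F : G → ℝ≥0∞) :
    M.nnNorm (fun x => c * F x) = c * M.nnNorm F := by
  simp only [nnNorm, mul_left_comm _ c, ENNReal.mul_rpow_of_nonneg _ _ M.toReal_pos.le]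
  rw [lintegral_const_mul' _ _ (ENNReal.rpow_ne_top_of_nonneg M.toReal_pos.le hc),
    ENNReal.mul_rpow_of_nonneg _ _ (inv_pos.2 M.toReal_pos).le,
    ← ENNReal.rpow_mul, mul_inv_cancel₀ M.toReal_pos.ne', ENNReal.rpow_one]

variable [IsTopologicalGroup G] [LocallyCompactSpace G] [SecondCountableTopology G]
  [BorelSpace G] [μ.IsHaarMeasure]

/-- For y ∈ x_i V the point x_i⁻¹x lies in V y⁻¹x, so |W(x_i⁻¹x)| is at most the maximal function of
W at y⁻¹x. Averaging over y ∈ x_i V dominates the sum by μ(V)⁻¹ times the convolution of ∑ a_i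
1_{x_i V} with that maximal function. -/
theorem exists_nnNorm_tsum_translate_le (hX : IsRelativelySeparated X) {Q : Set G}
    (hQ : IsCompact Q) (hQ1 : Q ∈ 𝓝 (1 : G)) {W : G → ℂ} (hW : Continuous W)
    (hWQ : maxL1 S (supFun (interior Q) W) < ⊤) :
    ∃ C : ℝ≥0∞, C < ⊤ ∧ ∀ a : I → ℝ≥0∞,
      M.nnNorm (fun x => ∑' i, a i * ‖W ((X i)⁻¹ * x)‖ₑ) ≤ C * M.ellNorm X a := by
  have := hX.countable
  set V := interior Q
  have hVm : MeasurableSet V := isOpen_interior.measurableSet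
  have hV0 : μ V ≠ 0 :=
    (isOpen_interior.measure_pos μ ⟨1, mem_interior_iff_mem_nhds.2 hQ1⟩).ne'
  have hVt : μ V ≠ ⊤ := ((measure_mono interior_subset).trans_lt hQ.measure_lt_top).ne
  obtain ⟨C, hC, hCa⟩ := M.exists_nnNorm_tsum_indicator_le hX hQ hQ1 hVm interior_subset
  refine ⟨(μ V)⁻¹ * (maxL1 S (supFun V W) * C), ENNReal.mul_lt_top
    (ENNReal.inv_lt_top.2 (pos_iff_ne_zero.2 hV0)) (ENNReal.mul_lt_top hWQ hC), fun a => ?_⟩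
  set E : I → Set G := fun i => (fun q => X i * q) '' V
  have hE : ∀ i, MeasurableSet (E i) := fun i => by
    simp only [E]
    rw [Set.image_mul_left]
    exact measurable_const_mul _ hVm
  set D : G → ℝ≥0∞ := fun y => ∑' i, a i * (E i).indicator (fun _ => 1) y
  have hDi : ∀ i, Measurable fun y => a i * (E i).indicator (fun _ => (1 : ℝ≥0∞)) y := fun i =>
    (measurable_const.indicator (hE i)).const_mul _
  have hD : Measurable D := Measurable.tsum hDi
  have hsup := measurable_supFun V hW
  have hpt : ∀ x, ∑' i, a i * ‖W ((X i)⁻¹ * x)‖ₑ ≤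
      (μ V)⁻¹ * ∫⁻ y, D y * supFun V W (y⁻¹ * x) ∂μ := by
    intro x
    have hsx : Measurable fun y => supFun V W (y⁻¹ * x) :=
      hsup.comp (continuous_inv.mul continuous_const).measurable
    have h1 : ∫⁻ y, D y * supFun V W (y⁻¹ * x) ∂μ =
        ∑' i, ∫⁻ y, a i * (E i).indicator (fun _ => 1) y * supFun V W (y⁻¹ * x) ∂μ := by
      refine Eq.trans ?_ (lintegral_tsum fun i => ((hDi i).mul hsx).aemeasurable)
      refine lintegral_congr fun y => ?_
      exact ENNReal.tsum_mul_right.symm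
    rw [h1, ← ENNReal.tsum_mul_left]
    refine ENNReal.tsum_le_tsum fun i => ?_
    rw [mul_comm (μ V)⁻¹, ← div_eq_mul_inv, ENNReal.le_div_iff_mul_le (Or.inl hV0) (Or.inl hVt)]
    calc a i * ‖W ((X i)⁻¹ * x)‖ₑ * μ V
        = ∫⁻ y, (E i).indicator (fun _ => a i * ‖W ((X i)⁻¹ * x)‖ₑ) y ∂μ := by
          rw [lintegral_indicator_const (hE i), measure_image_mul_left]
      _ ≤ _ := by
          refine lintegral_mono fun y => ?_
          by_cases hy : y ∈ E i
          · rw [Set.indicator_of_mem hy, Set.indicator_of_mem hy, mul_one]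
            gcongr
            have h2 := enorm_le_supFun W (mem_image_mul_left_iff.1 hy) (y⁻¹ * x)
            rwa [mul_assoc, mul_inv_cancel_left] at h2
          · rw [Set.indicator_of_notMem hy]
            exact zero_le
  calc M.nnNorm (fun x => ∑' i, a i * ‖W ((X i)⁻¹ * x)‖ₑ)
      ≤ M.nnNorm (fun x => (μ V)⁻¹ * ∫⁻ y, D y * supFun V W (y⁻¹ * x) ∂μ) :=
        M.nnNorm_mono (Eventually.of_forall hpt)
    _ = (μ V)⁻¹ * M.nnNorm (fun x => ∫⁻ y, D y * supFun V W (y⁻¹ * x) ∂μ) :=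
        M.nnNorm_const_mul (ENNReal.inv_ne_top.2 hV0) _
    _ ≤ (μ V)⁻¹ * (maxL1 S (supFun V W) * (C * M.ellNorm X a)) := by
        gcongr
        exact (M.nnNorm_conv_le hD.aemeasurable hsup).trans (by gcongr; exact hCa a)
    _ = _ := by ring

/-- The function `∑ c_i W(x_i⁻¹ ·)`. -/
def synthFun (X : I → G) (W : G → ℂ) (c : I → ℂ) (x : G) : ℂ :=
  ∑' i, c i * W ((X i)⁻¹ * x)

variable {M}

theorem exists_synthFun_bound (hX : IsRelativelySeparated X) {Q : Set G}
    (hQ : IsCompact Q) (hQ1 : Q ∈ 𝓝 (1 : G)) {W : G → ℂ} (hW : Continuous W)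
    (hWQ : maxL1 S (supFun (interior Q) W) < ⊤) :
    ∃ C : ℝ≥0∞, C < ⊤ ∧ ∀ c ∈ M.ellSubmodule X,
      (∀ᵐ x ∂μ, Summable fun i => c i * W ((X i)⁻¹ * x)) ∧
      MemLpW μ M.m M.r (synthFun X W c) ∧
      normLpW μ M.m M.r (synthFun X W c) ≤ C * M.ellNorm X fun i => ‖c i‖ₑ := by
  have := hX.countable
  obtain ⟨C, hC, hCa⟩ := M.exists_nnNorm_tsum_translate_le hX hQ hQ1 hW hWQ
  refine ⟨C, hC, fun c hc => ?_⟩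
  have hWi : ∀ i, Continuous fun x => W ((X i)⁻¹ * x) := fun i =>
    hW.comp (continuous_const_mul _)
  have hlt : M.nnNorm (fun x => ∑' i, ‖c i‖ₑ * ‖W ((X i)⁻¹ * x)‖ₑ) < ⊤ :=
    (hCa _).trans_lt (ENNReal.mul_lt_top hC ((M.mem_ell_iff X c).1 hc))
  have hmeas : Measurable fun x => ∑' i, ‖c i‖ₑ * ‖W ((X i)⁻¹ * x)‖ₑ :=
    Measurable.tsum fun i => ((hWi i).enorm.measurable.const_mul _)
  have hsum : ∀ᵐ x ∂μ, Summable fun i => c i * W ((X i)⁻¹ * x) := by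
    filter_upwards [M.ae_lt_top_of_nnNorm hmeas.aemeasurable hlt] with x hx
    refine Summable.of_nnnorm ?_
    rw [← tsum_enorm_ne_top_iff_summable_nnnorm]
    simpa only [enorm_mul] using hx.ne
  have hle : M.nnNorm (fun x => ‖synthFun X W c x‖ₑ) ≤ C * M.ellNorm X fun i => ‖c i‖ₑ := by
    refine (M.nnNorm_mono (Eventually.of_forall fun x => ?_)).trans (hCa _)
    refine enorm_tsum_le_tsum_enorm.trans_eq ?_
    simp only [enorm_mul]
  refine ⟨hsum, (M.memLpW_iff _).2 ⟨?_, hle.trans_lt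
    (ENNReal.mul_lt_top hC ((M.mem_ell_iff X c).1 hc))⟩, ?_⟩
  · refine aestronglyMeasurable_of_tendsto_ae (u := (atTop : Filter (Finset I)))
      (f := fun s x => ∑ i ∈ s, c i * W ((X i)⁻¹ * x)) (fun s => ?_) ?_
    · exact (continuous_finsetSum s fun i _ =>
        continuous_const.mul (hWi i)).measurable.aestronglyMeasurable
    · filter_upwards [hsum] with x hx
      exact hx.hasSum
  · rw [normLpW_eq_nnNorm]
    exact hle

/-- The synthesis operator, and its description as `c ↦ (∑ c_i W(x_i⁻¹ ·)) * K`. -/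
theorem exists_synth (hM : BoundedRC μ M.m M.r S.kernel) (hX : IsRelativelySeparated X) {Q : Set G}
    (hQ : IsCompact Q) (hQ1 : Q ∈ 𝓝 (1 : G)) {W : G → ℂ} (hW : Continuous W)
    (hWQ : maxL1 S (supFun (interior Q) W) < ⊤) (hWK : groupConv μ W S.kernel =ᵐ[μ] S.kernel) :
    ∃ Synth : M.Ell X →L[ℂ] M.Co,
      (∀ c : M.Ell X, HasSum (fun i => M.coeffs X c i • M.atom (X i)) (Synth c)) ∧
      ∀ c : M.Ell X, (∀ᵐ x ∂μ, Summable fun i => M.coeffs X c i * W ((X i)⁻¹ * x)) ∧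
        ∃ h : MemLpW μ M.m M.r (synthFun X W (M.coeffs X c)), Synth c = ofFun hM _ h := by
  classical
  obtain ⟨C, hC, hb⟩ := exists_synthFun_bound (M := M) hX hQ hQ1 hW hWQ
  have hmem : ∀ c : M.Ell X, MemLpW μ M.m M.r (synthFun X W (M.coeffs X c)) := fun c =>
    (hb _ c.2).2.1
  let L : M.Ell X →ₗ[ℂ] M.Co :=
    { toFun := fun c => ofFun hM _ (hmem c)
      map_add' := fun a b => by
        have hadd : synthFun X W (M.coeffs X (a + b)) =ᵐ[μ]
            synthFun X W (M.coeffs X a) + synthFun X W (M.coeffs X b) := by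
          filter_upwards [(hb _ a.2).1, (hb _ b.2).1] with x ha hb
          refine Eq.trans (tsum_congr fun i => ?_) (ha.tsum_add hb)
          exact add_mul _ _ _
        have h2 : MemLpW μ M.m M.r
            (synthFun X W (M.coeffs X a) + synthFun X W (M.coeffs X b)) := by
          refine MemLp.ae_eq ?_ (hmem (a + b))
          filter_upwards [hadd] with x hx
          rw [hx]
        rw [ofFun_congr_ae hM (hmem (a + b)) h2 hadd]
        exact ofFun_add hM (hmem a) (hmem b) h2
      map_smul' := fun z a => by
        have hsmul : synthFun X W (M.coeffs X (z • a)) = z • synthFun X W (M.coeffs X a) := by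
          funext x
          change ∑' i, _ = z * ∑' i, _
          rw [← tsum_mul_left]
          refine tsum_congr fun i => ?_
          exact mul_assoc _ _ _
        have h2 : MemLpW μ M.m M.r (z • synthFun X W (M.coeffs X a)) := hsmul ▸ hmem (z • a)
        rw [ofFun_congr_ae hM (hmem (z • a)) h2 (by rw [hsmul])]
        exact ofFun_smul hM z (hmem a) h2 }
  set D : ℝ≥0∞ := normRC μ M.m M.r S.kernel * C
  have hD : D ≠ ⊤ := ENNReal.mul_ne_top hM.2.ne hC.ne
  let Sy : M.Ell X →L[ℂ] M.Co := L.mkContinuous D.toReal fun c => by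
    have h1 : ‖L c‖ₑ ≤ D * ‖c‖ₑ := by
      refine (enorm_ofFun_le hM (hmem c)).trans ?_
      rw [enorm_ell, mul_assoc]
      gcongr
      exact (hb _ c.2).2.2
    have h2 := ENNReal.toReal_mono (ENNReal.mul_ne_top hD enorm_ne_top) h1
    rwa [ENNReal.toReal_mul, toReal_enorm, toReal_enorm] at h2
  refine ⟨Sy, fun c => ?_, fun c => ⟨(hb _ c.2).1, hmem c, rfl⟩⟩
  -- Translating W * K = K gives W(x_i⁻¹ ·) * K = K(x_i⁻¹ ·), which is the voice transform of
  -- π(x_i)u.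
  have hsingle : ∀ i (a : ℂ), Sy (M.ellSingle X i a) = a • M.atom (X i) := by
    intro i a
    refine eq_of_extVoice_ae_eq ?_
    have h1 : S.extVoice (M.incl (Sy (M.ellSingle X i a))) =
        groupConv μ (synthFun X W (M.coeffs X (M.ellSingle X i a))) S.kernel :=
      extVoice_ofFun hM (hmem _)
    have h2 : ∀ x, synthFun X W (M.coeffs X (M.ellSingle X i a)) x = a * W ((X i)⁻¹ * x) := by
      intro x
      rw [coeffs_ellSingle, synthFun, tsum_eq_single i, Pi.single_eq_same]
      intro j hj
      rw [Pi.single_eq_of_ne hj, zero_mul]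
    have h3 := (measurePreserving_mul_left μ (X i)⁻¹).quasiMeasurePreserving.ae hWK
    filter_upwards [h3] with x hx
    rw [h1, map_smul]
    change _ = a * S.voice (S.π (X i) S.u) x
    rw [voice_translate, ← hx, groupConv, groupConv, ← integral_const_mul,
      ← integral_mul_left_eq_self _ (X i)]
    refine integral_congr_ae (Eventually.of_forall fun y => ?_)
    simp only [h2, inv_mul_cancel_left, mul_inv_rev, mul_assoc]
  have h := Sy.hasSum (M.hasSum_ellSingle X c)
  simpa only [hsingle] using h

/-! ### Local means and the discretization error. -/

section Coefficients

variable {U : Set G} {ψ : I → G → ℝ}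

theorem lintegral_bupu_le (hψ : IsBUPU U X ψ) (F : G → ℝ≥0∞) (i : I) :
    ∫⁻ x, F x * ENNReal.ofReal (ψ i x) ∂μ ≤
      ∫⁻ x, F x * ((fun q => X i * q) '' U).indicator (fun _ => 1) x ∂μ := by
  refine lintegral_mono fun x => ?_
  by_cases hx : x ∈ (fun q => X i * q) '' U
  · rw [Set.indicator_of_mem hx]
    gcongr
    exact ENNReal.ofReal_le_one.2 (hψ.mem_Icc i x).2
  · rw [hψ.eq_zero i x hx]
    simp

theorem tsum_ofReal_bupu (hψ : IsBUPU U X ψ) (x : G) : ∑' i, ENNReal.ofReal (ψ i x) = 1 := by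
  rw [← ENNReal.ofReal_tsum_of_nonneg (fun i => (hψ.mem_Icc i x).1) (hψ.sum_eq_one x).summable,
    (hψ.sum_eq_one x).tsum_eq, ENNReal.ofReal_one]

theorem enorm_mul_bupu (hψ : IsBUPU U X ψ) (f : G → ℂ) (i : I) (x : G) :
    ‖f x * (ψ i x : ℂ)‖ₑ = ‖f x‖ₑ * ENNReal.ofReal (ψ i x) := by
  rw [enorm_mul, enorm_complex_ofReal, Real.enorm_of_nonneg (hψ.mem_Icc i x).1]

variable (M) in
/-- The operator `T ↦ (∫ V_e T ψ_i)_i`. -/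
theorem exists_localMeans (hψ : IsBUPU U X ψ) (hU : IsCompact U) (hU1 : U ∈ 𝓝 (1 : G))
    (hUm : MeasurableSet U) :
    ∃ C₀ : M.Co →L[ℂ] M.Ell X, ∀ T i,
      Integrable (fun y => S.extVoice (M.incl T) y * (ψ i y : ℂ)) μ ∧
      M.coeffs X (C₀ T) i = ∫ y, S.extVoice (M.incl T) y * (ψ i y : ℂ) ∂μ := by
  obtain ⟨C, hC, hCF⟩ := M.exists_ellNorm_lintegral_le hψ.relSep hU hU1 hUm
  have hfm : ∀ T : M.Co, AEStronglyMeasurable (S.extVoice (M.incl T)) μ := fun T =>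
    aestronglyMeasurable_of_memLpW T.2
  have hell : ∀ T : M.Co, M.ellNorm X (fun i => ∫⁻ y, ‖S.extVoice (M.incl T) y‖ₑ *
      ((fun q => X i * q) '' U).indicator (fun _ => 1) y ∂μ) ≤ C * ‖T‖ₑ := fun T => by
    rw [enorm_co, normLpW_eq_nnNorm]
    exact hCF _ (hfm T).enorm
  have hint : ∀ (T : M.Co) i,
      Integrable (fun y => S.extVoice (M.incl T) y * (ψ i y : ℂ)) μ := by
    intro T i
    refine ⟨(hfm T).mul
      (Complex.measurable_ofReal.comp (hψ.measurable i)).aestronglyMeasurable, ?_⟩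
    simp only [HasFiniteIntegral, enorm_mul_bupu hψ]
    -- Since m(x_i) > 0, a single infinite local mean would make the sequence norm infinite.
    refine (lintegral_bupu_le hψ _ i).trans_lt (lt_top_iff_ne_top.2 fun htop => ?_)
    have h1 := (hell T).trans_lt (ENNReal.mul_lt_top hC enorm_lt_top)
    rw [ellNorm, ENNReal.rpow_lt_top_iff_of_pos (inv_pos.2 M.toReal_pos)] at h1
    have h2 := (ENNReal.le_tsum i).trans_lt h1
    rw [htop, ENNReal.mul_top (by simpa using M.m_pos (X i)),
      ENNReal.top_rpow_of_pos M.toReal_pos] at h2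
    exact lt_irrefl _ h2
  let c : M.Co → I → ℂ := fun T i => ∫ y, S.extVoice (M.incl T) y * (ψ i y : ℂ) ∂μ
  have hc : ∀ T, M.ellNorm X (fun i => ‖c T i‖ₑ) ≤ C * ‖T‖ₑ := by
    intro T
    refine le_trans ?_ (hell T)
    refine ENNReal.rpow_le_rpow (ENNReal.tsum_le_tsum fun i => ?_) (inv_pos.2 M.toReal_pos).le
    refine ENNReal.rpow_le_rpow ?_ M.toReal_pos.le
    gcongr
    refine (enorm_integral_le_lintegral_enorm _).trans ?_
    simp only [enorm_mul_bupu hψ]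
    exact lintegral_bupu_le hψ _ i
  let L : M.Co →ₗ[ℂ] M.Ell X :=
    { toFun := fun T => ⟨c T, (M.mem_ell_iff X _).2
        ((hc T).trans_lt (ENNReal.mul_lt_top hC enorm_lt_top))⟩
      map_add' := fun a b => Subtype.ext (funext fun i => by
        change c (a + b) i = c a i + c b i
        simp only [c]
        rw [← integral_add (hint a i) (hint b i)]
        refine integral_congr_ae (Eventually.of_forall fun y => ?_)
        simp only [map_add]
        exact add_mul _ _ _)
      map_smul' := fun z a => Subtype.ext (funext fun i => by
        change c (z • a) i = z * c a i
        simp only [c]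
        rw [← integral_const_mul]
        refine integral_congr_ae (Eventually.of_forall fun y => ?_)
        simp only [map_smul]
        exact mul_assoc _ _ _) }
  refine ⟨L.mkContinuous C.toReal fun T => ?_, fun T i => ⟨hint T i, rfl⟩⟩
  have h1 : ‖L T‖ₑ ≤ C * ‖T‖ₑ := by
    rw [enorm_ell]
    exact hc T
  have h2 := ENNReal.toReal_mono (ENNReal.mul_ne_top hC.ne enorm_ne_top) h1
  rwa [ENNReal.toReal_mul, toReal_enorm, toReal_enorm] at h2

/-- The discretization of a convolution: `f * W - ∑ ⟨f, ψ_i⟩ W(x_i⁻¹ ·)` is dominated by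
`|f| * osc_U W`. -/
theorem ae_enorm_groupConv_sub_synthFun_le (hψ : IsBUPU U X ψ) {f : G → ℂ}
    (hf : MemLpW μ M.m M.r f) {W : G → ℂ} (hW : Continuous W)
    (hW1 : maxL1 S (fun x => ‖W x‖ₑ) < ⊤) (hfi : ∀ i, Integrable (fun y => f y * (ψ i y : ℂ)) μ)
    (hsum : ∀ᵐ x ∂μ, Summable fun i => (∫ y, f y * (ψ i y : ℂ) ∂μ) * W ((X i)⁻¹ * x)) :
    ∀ᵐ x ∂μ, ‖(groupConv μ f W - synthFun X W fun i => ∫ y, f y * (ψ i y : ℂ) ∂μ) x‖ₑ ≤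
      ∫⁻ y, ‖f y‖ₑ * osc U W (y⁻¹ * x) ∂μ := by
  have := hψ.relSep.countable
  have hfm := aestronglyMeasurable_of_memLpW hf
  have hψm : ∀ i, AEStronglyMeasurable (fun y => (ψ i y : ℂ)) μ := fun i =>
    (Complex.measurable_ofReal.comp (hψ.measurable i)).aestronglyMeasurable
  filter_upwards [ae_integrable_conv hf hW hW1, hsum] with x hx hsx
  have hWx : AEStronglyMeasurable (fun y => W (y⁻¹ * x)) μ :=
    (hW.comp (continuous_inv.mul continuous_const)).measurable.aestronglyMeasurable
  -- The partition of unity splits the convolution; the majorants ψ_i(y) |f(y) W(y⁻¹x)| sum to an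
  -- integrable function.
  have h1 : HasSum (fun i => ∫ y, f y * (ψ i y : ℂ) * W (y⁻¹ * x) ∂μ) (groupConv μ f W x) := by
    refine hasSum_integral_of_dominated_convergence
      (fun i y => ψ i y * ‖f y * W (y⁻¹ * x)‖) (fun i => (hfm.mul (hψm i)).mul hWx)
      (fun i => Eventually.of_forall fun y => ?_) (Eventually.of_forall fun y => ?_) ?_
      (Eventually.of_forall fun y => ?_)
    · rw [norm_mul, norm_mul, norm_mul, Complex.norm_real,
        Real.norm_of_nonneg (hψ.mem_Icc i y).1]
      exact le_of_eq (by ring)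
    · exact (hψ.sum_eq_one y).summable.mul_right _
    · refine hx.norm.congr (Eventually.of_forall fun y => ?_)
      change _ = ∑' i, _
      rw [tsum_mul_right, (hψ.sum_eq_one y).tsum_eq, one_mul]
    · have h2 : HasSum (fun i => (ψ i y : ℂ)) 1 := by
        rw [← Complex.ofReal_one]
        exact Complex.hasSum_ofReal.2 (hψ.sum_eq_one y)
      have h3 := (h2.mul_left (f y)).mul_right (W (y⁻¹ * x))
      rwa [mul_one] at h3
  have h2 := h1.sub hsx.hasSum
  have h3 : (groupConv μ f W - synthFun X W fun i => ∫ y, f y * (ψ i y : ℂ) ∂μ) x =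
      ∑' i, (∫ y, f y * (ψ i y : ℂ) * W (y⁻¹ * x) ∂μ -
        (∫ y, f y * (ψ i y : ℂ) ∂μ) * W ((X i)⁻¹ * x)) := h2.tsum_eq.symm
  have hdiff : ∀ i, ‖∫ y, f y * (ψ i y : ℂ) * W (y⁻¹ * x) ∂μ -
      (∫ y, f y * (ψ i y : ℂ) ∂μ) * W ((X i)⁻¹ * x)‖ₑ ≤
      ∫⁻ y, ENNReal.ofReal (ψ i y) * (‖f y‖ₑ * osc U W (y⁻¹ * x)) ∂μ := by
    intro i
    have hi1 : Integrable (fun y => f y * (ψ i y : ℂ) * W (y⁻¹ * x)) μ := by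
      refine hx.mono ((hfm.mul (hψm i)).mul hWx) (Eventually.of_forall fun y => ?_)
      rw [norm_mul, norm_mul, norm_mul, Complex.norm_real,
        Real.norm_of_nonneg (hψ.mem_Icc i y).1]
      gcongr
      exact mul_le_of_le_one_right (norm_nonneg _) (hψ.mem_Icc i y).2
    rw [← integral_mul_const, ← integral_sub hi1 ((hfi i).mul_const _)]
    refine (enorm_integral_le_lintegral_enorm _).trans (lintegral_mono fun y => ?_)
    rw [← mul_sub, enorm_mul, enorm_mul_bupu hψ, mul_comm ‖f y‖ₑ, mul_assoc]
    -- For y ∈ x_i U write x_i⁻¹x = u (y⁻¹x) with u = x_i⁻¹y ∈ U; elsewhere ψ_i vanishes.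
    by_cases hy : y ∈ (fun q => X i * q) '' U
    · gcongr
      have h4 : ‖W ((X i)⁻¹ * y * (y⁻¹ * x)) - W (y⁻¹ * x)‖ₑ ≤ osc U W (y⁻¹ * x) :=
        le_iSup₂ (f := fun u (_ : u ∈ U) => ‖W (u * (y⁻¹ * x)) - W (y⁻¹ * x)‖ₑ) _
          (mem_image_mul_left_iff.1 hy)
      rwa [mul_assoc, mul_inv_cancel_left, ← enorm_neg, neg_sub] at h4
    · rw [hψ.eq_zero i y hy]
      simp
  rw [h3]
  refine enorm_tsum_le_tsum_enorm.trans ((ENNReal.tsum_le_tsum hdiff).trans ?_)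
  have hosc : AEMeasurable (fun y => ‖f y‖ₑ * osc U W (y⁻¹ * x)) μ :=
    hfm.enorm.mul ((measurable_osc U hW).comp
      (continuous_inv.mul continuous_const).measurable).aemeasurable
  refine le_of_eq ((lintegral_tsum fun i =>
    (hψ.measurable i).ennreal_ofReal.aemeasurable.mul hosc).symm.trans
    (lintegral_congr fun y => ?_))
  refine ENNReal.tsum_mul_right.trans ?_
  rw [tsum_ofReal_bupu hψ, one_mul]

/-- The synthesis and coefficient operators of an admissible model, with the coefficients given by
a Neumann series. -/
theorem exists_synth_localMeans_neumann (hψ : IsBUPU U X ψ) (hU : IsCompact U)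
    (hU1 : U ∈ 𝓝 (1 : G)) (hUm : MeasurableSet U) (hM : M.Admissible U) :
    ∃ (Sy : M.Ell X →L[ℂ] M.Co) (C₀ : M.Co →L[ℂ] M.Ell X) (B : M.Co →L[ℂ] M.Co),
      (∀ c : M.Ell X, HasSum (fun i => M.coeffs X c i • M.atom (X i)) (Sy c)) ∧
      (∀ T i, M.coeffs X (C₀ T) i = ∫ y, S.extVoice (M.incl T) y * (ψ i y : ℂ) ∂μ) ∧
      (Sy.comp C₀).comp B = ContinuousLinearMap.id ℂ M.Co ∧
      ∀ T, HasSum (fun n : ℕ => ((ContinuousLinearMap.id ℂ M.Co - Sy.comp C₀) ^ n) T) (B T) := by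
  obtain ⟨hRC, W, hW, ⟨-, hWK⟩, ⟨Q, hQ, hQ1, hQw, hQΔ⟩, hosc⟩ := hM
  have hsup : maxL1 S (supFun (interior Q) W) < ⊤ := max_lt
    ((normL1_mono μ _ fun x => supFun_interior_le_maxFun μ Q hW x).trans_lt hQw)
    ((normL1_mono μ _ fun x => supFun_interior_le_maxFun μ Q hW x).trans_lt hQΔ)
  have hWle : ∀ x, ‖W x‖ₑ ≤ supFun (interior Q) W x := fun x => by
    have := enorm_le_supFun W (mem_interior_iff_mem_nhds.2 hQ1) x
    rwa [one_mul] at this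
  have hW1 : maxL1 S (fun x => ‖W x‖ₑ) < ⊤ :=
    (max_le_max (normL1_mono μ _ hWle) (normL1_mono μ _ hWle)).trans_lt hsup
  obtain ⟨Sy, hSy, hSyf⟩ := exists_synth hRC hψ.relSep hQ hQ1 hW hsup hWK
  obtain ⟨C₀, hC₀⟩ := exists_localMeans M hψ hU hU1 hUm
  have key : ∀ T : M.Co, ‖T - Sy (C₀ T)‖ₑ ≤
      oscConst S U W * normRC μ M.m M.r S.kernel * ‖T‖ₑ := by
    intro T
    set f := S.extVoice (M.incl T)
    have hf : MemLpW μ M.m M.r f := T.2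
    obtain ⟨hsum, hmem, hSyT⟩ := hSyf (C₀ T)
    have hcoef : M.coeffs X (C₀ T) = fun i => ∫ y, f y * (ψ i y : ℂ) ∂μ :=
      funext fun i => (hC₀ T i).2
    have hfW := memLpW_groupConv hf hW hW1
    -- T is represented by V_e T * W as well, because (V_e T * W) * K = V_e T * K.
    have hT : ofFun hRC _ hfW = T := by
      refine Eq.trans ?_ (ofFun_extVoice hRC T)
      refine eq_of_extVoice_ae_eq ?_
      have h := groupConv_groupConv_ae_eq hRC hf hW hW1 hWK
      rwa [← extVoice_ofFun hRC hfW, ← extVoice_ofFun hRC hf] at h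
    have hsub := memLpW_sub hfW hmem
    have h1 : T - Sy (C₀ T) = ofFun hRC _ hsub := by
      rw [ofFun_sub hRC hfW hmem, hT, hSyT]
    have h2 : normLpW μ M.m M.r (groupConv μ f W - synthFun X W (M.coeffs X (C₀ T))) ≤
        oscConst S U W * ‖T‖ₑ := by
      rw [enorm_co, normLpW_eq_nnNorm, normLpW_eq_nnNorm, hcoef]
      rw [hcoef] at hsum
      refine (M.nnNorm_mono ?_).trans (M.nnNorm_conv_le (aestronglyMeasurable_of_memLpW hf).enorm
        (measurable_osc U hW))
      exact ae_enorm_groupConv_sub_synthFun_le hψ hf hW hW1 (fun i => (hC₀ T i).1) hsum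
    rw [h1]
    refine (enorm_ofFun_le hRC hsub).trans ?_
    calc _ ≤ normRC μ M.m M.r S.kernel * (oscConst S U W * ‖T‖ₑ) := by gcongr
      _ = _ := by ring
  have hne : oscConst S U W * normRC μ M.m M.r S.kernel ≠ ⊤ :=
    (hosc.trans ENNReal.one_lt_top).ne
  have hcomplete := completeSpace_co hRC
  obtain ⟨B, hB1, hB2⟩ := exists_hasSum_neumann M.eq_zero_of_norm_eq_zero (Sy.comp C₀)
    (q := (oscConst S U W * normRC μ M.m M.r S.kernel).toReal) ENNReal.toReal_nonneg
    (by
      have := (ENNReal.toReal_lt_toReal hne ENNReal.one_ne_top).2 hosc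
      rwa [ENNReal.toReal_one] at this)
    fun T => by
      have h := ENNReal.toReal_mono (ENNReal.mul_ne_top hne enorm_ne_top) (key T)
      rwa [ENNReal.toReal_mul, toReal_enorm, toReal_enorm] at h
  exact ⟨Sy, C₀, B, hSy, fun T i => (hC₀ T i).2, hB1, hB2⟩

end Coefficients

/-! ### Independence of the model. -/

section Independence

variable {M₁ M₂ : S.Model}

/-- Both sums converge pointwise on the test space, where limits are unique. -/
theorem incl_eq_of_hasSum {ι : Type*} {t₁ : ι → M₁.Co} {t₂ : ι → M₂.Co} {T₁ : M₁.Co} {T₂ : M₂.Co}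
    (h : ∀ i, M₁.incl (t₁ i) = M₂.incl (t₂ i)) (h₁ : HasSum t₁ T₁) (h₂ : HasSum t₂ T₂) :
    M₁.incl T₁ = M₂.incl T₂ := by
  refine ContinuousLinearMap.ext fun v => ?_
  refine tendsto_nhds_unique (M₁.tendsto_incl_apply h₁ v)
    ((M₂.tendsto_incl_apply h₂ v).congr fun s => ?_)
  rw [map_sum, map_sum, Finset.sum_congr rfl fun i _ => h i]

/-- Neumann series of operators that agree on the intersection of two coorbit spaces agree. -/
theorem incl_neumann_eq {A₁ B₁ : M₁.Co →L[ℂ] M₁.Co} {A₂ B₂ : M₂.Co →L[ℂ] M₂.Co}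
    (hA : ∀ (T₁ : M₁.Co) (T₂ : M₂.Co), M₁.incl T₁ = M₂.incl T₂ →
      M₁.incl (A₁ T₁) = M₂.incl (A₂ T₂))
    (h₁ : ∀ T, HasSum (fun n : ℕ => ((ContinuousLinearMap.id ℂ M₁.Co - A₁) ^ n) T) (B₁ T))
    (h₂ : ∀ T, HasSum (fun n : ℕ => ((ContinuousLinearMap.id ℂ M₂.Co - A₂) ^ n) T) (B₂ T))
    {T₁ : M₁.Co} {T₂ : M₂.Co} (h : M₁.incl T₁ = M₂.incl T₂) :
    M₁.incl (B₁ T₁) = M₂.incl (B₂ T₂) := by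
  refine incl_eq_of_hasSum (fun n => ?_) (h₁ T₁) (h₂ T₂)
  induction n with
  | zero => exact h
  | succ n ih =>
    -- The new factor is split off on the outside, so that `hA` applies to the iterates already
    -- known to agree.
    rw [pow_succ', pow_succ']
    exact (map_sub M₁.incl _ _).trans
      ((congrArg₂ (· - ·) ih (hA _ _ ih)).trans (map_sub M₂.incl _ _).symm)

end Independence

end Model

end CoorbitSetting

end

theorem theorem5 {G : Type*} [Group G] [TopologicalSpace G] [IsTopologicalGroup G]
    [LocallyCompactSpace G] [SecondCountableTopology G] [T2Space G]
    [MeasurableSpace G] [BorelSpace G] (μ : Measure G) [μ.IsHaarMeasure]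
    {H : Type*} [NormedAddCommGroup H] [InnerProductSpace ℂ H] [CompleteSpace H]
    [TopologicalSpace.SeparableSpace H] (S : CoorbitSetting μ H)
    (U : Set G) (hU : IsCompact U) (hU1 : U ∈ 𝓝 (1 : G))
    {I : Type*} (X : I → G) (ψ : I → G → ℝ) (hψ : IsBUPU U X ψ) :
    ∃ (Synth : ∀ M : S.Model, M.Admissible U → (M.Ell X →L[ℂ] M.Co))
      (Coef : ∀ M : S.Model, M.Admissible U → (M.Co →L[ℂ] M.Ell X)),
      (∀ (M : S.Model) (hM : M.Admissible U),
        (∀ c : M.Ell X, HasSum (fun i => M.coeffs X c i • M.atom (X i)) (Synth M hM c)) ∧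
        (Synth M hM).comp (Coef M hM) = ContinuousLinearMap.id ℂ M.Co) ∧
      ∀ (M₁ M₂ : S.Model) (h₁ : M₁.Admissible U) (h₂ : M₂.Admissible U)
        (T₁ : M₁.Co) (T₂ : M₂.Co), M₁.incl T₁ = M₂.incl T₂ →
          M₁.coeffs X (Coef M₁ h₁ T₁) = M₂.coeffs X (Coef M₂ h₂ T₂) := by
  have hUm : MeasurableSet U := hU.measurableSet
  choose Sy C₀ B hSy hC₀ hid hB using fun (M : S.Model) (hM : M.Admissible U) =>
    CoorbitSetting.Model.exists_synth_localMeans_neumann hψ hU hU1 hUm hM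
  have hcoef : ∀ (M₁ M₂ : S.Model) (h₁ : M₁.Admissible U) (h₂ : M₂.Admissible U)
      (T₁ : M₁.Co) (T₂ : M₂.Co), M₁.incl T₁ = M₂.incl T₂ →
        M₁.coeffs X (C₀ M₁ h₁ T₁) = M₂.coeffs X (C₀ M₂ h₂ T₂) := by
    intro M₁ M₂ h₁ h₂ T₁ T₂ h
    funext i
    rw [hC₀, hC₀, h]
  refine ⟨Sy, fun M hM => (C₀ M hM).comp (B M hM), fun M hM => ⟨hSy M hM, hid M hM⟩, ?_⟩
  intro M₁ M₂ h₁ h₂ T₁ T₂ h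
  refine hcoef M₁ M₂ h₁ h₂ _ _ (CoorbitSetting.Model.incl_neumann_eq (fun R₁ R₂ hR => ?_)
    (hB M₁ h₁) (hB M₂ h₂) h)
  -- The functions W of the two models may differ, but each Synth C₀ R is the sum of the same atoms
  -- with the same coefficients.
  refine CoorbitSetting.Model.incl_eq_of_hasSum (fun i => ?_) (hSy M₁ h₁ _) (hSy M₂ h₂ _)
  rw [map_smul, map_smul]
  exact congrArg (· • S.embed (S.π (X i) S.u)) (congrFun (hcoef M₁ M₂ h₁ h₂ R₁ R₂ hR) i)
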